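/- Identify $\mathbb{CP}^1$ with the sphere at infinity of hyperbolic three-space $\mathbb{H}^3$. For a Jordan curve $C\subset\mathbb{CP}^1$ let $\mathrm{CH}(C)\subset\mathbb{H}^3$ be its convex hull, i.e. the smallest closed convex subset of $\mathbb{H}^3$ whose accumulation set at infinity is $C$. Let $\partial^+\mathrm{CH}(C)$ and $\partial^-\mathrm{CH}(C)$ be its two boundary surfaces, i.e. the frontiers of the two components of $\mathbb{H}^3\setminus\mathrm{CH}(C)$ (if $C$ is a round circle, $\mathrm{CH}(C)$ is a plane and both surfaces are equal to it). Let $d$ be the distance of $\mathbb{H}^3$, let $d_\pm$ be the induced path metric on $\partial^\pm\mathrm{CH}(C)$, i.e. the infimum of the lengths of paths in the surface, and let the boundary width of $C$ be $$w_\partial(C)=\max\Bigl(\sup_{x\in\partial^+\mathrm{CH}(C)}d(x,\partial^-\mathrm{CH}(C)),\ \sup_{x\in\partial^-\mathrm{CH}(C)}d(x,\partial^+\mathrm{CH}(C))\Bigr)\in[0,\infty].$$ Let $w_0=\cosh^{-1}(\sqrt2)$. Then for every $0\le w<w_0$ there are constants $L\ge1$ and $A\ge0$, depending only on $w$, such that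 the following holds for every Jordan curve $C$ with $w_\partial(C)\le w$. Let $\pi_+:\partial^-\mathrm{CH}(C)\to\partial^+\mathrm{CH}(C)$ and $\pi_-:\partial^+\mathrm{CH}(C)\to\partial^-\mathrm{CH}(C)$ be any nearest-point projections, i.e. any (not necessarily continuous) maps with $d(y,\pi_+(y))=d(y,\partial^+\mathrm{CH}(C))$ and $d(x,\pi_-(x))=d(x,\partial^-\mathrm{CH}(C))$ for all $y\in\partial^-\mathrm{CH}(C)$, $x\in\partial^+\mathrm{CH}(C)$. Then: 1. $\pi_+$ is an $(L,A)$-quasi-isometry from $(\partial^-\mathrm{CH}(C),d_-)$ to $(\partial^+\mathrm{CH}(C),d_+)$: for all $y,y'\in\partial^-\mathrm{CH}(C)$, $$\tfrac1L\,d_-(y,y')-A\le d_+(\pi_+(y),\pi_+(y'))\le L\,d_-(y,y')+A,$$ and every point of $\partial^+\mathrm{CH}(C)$ is at $d_+$-distance at most $A$ from the image of $\pi_+$; 2. likewise $\pi_-$ is an $(L,A)$-quasi-isometry from $(\partial^+\mathrm{CH}(C),d_+)$ to $(\partial^-\mathrm{CH}(C),d_-)$; 3. $\pi_+$ and $\pi_-$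 are quasi-inverse: $d_-(\pi_-(\pi_+(y)),y)\le A$ for all $y\in\partial^-\mathrm{CH}(C)$ and $d_+(\pi_+(\pi_-(x)),x)\le A$ for all $x\in\partial^+\mathrm{CH}(C)$. -/

import Mathlib

open Set Metric
open scoped NNReal ENNReal InnerProductSpace

/-- Euclidean three-space. -/
abbrev E3 : Type := EuclideanSpace ℝ (Fin 3)

/-- The sphere at infinity of hyperbolic three-space in the projective (Klein) model: the unit
sphere of Euclidean three-space, topologically the Riemann sphere. -/
abbrev SphereAtInfinity : Type := Metric.sphere (0 : E3) 1

/-- Hyperbolic three-space of curvature `-1`, in the projective (Beltrami-Klein) model: the open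
unit ball of Euclidean three-space. Its hyperbolic metric is defined below. -/
@[ext]
structure HypSpace where
  /-- the point of the open unit ball -/
  coord : E3
  norm_lt_one : ‖coord‖ < 1

namespace HypSpace

/-- The hyperbolic cosine of the distance between two points of the Klein model. -/
noncomputable def coshDist (x y : HypSpace) : ℝ :=
  (1 - ⟪x.coord, y.coord⟫_ℝ) / (√(1 - ‖x.coord‖ ^ 2) * √(1 - ‖y.coord‖ ^ 2))

noncomputable instance instDist : Dist HypSpace where
  dist x y := Real.arcosh (coshDist x y)

theorem dist_def (x y : HypSpace) : dist x y = Real.arcosh (coshDist x y) := rfl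

theorem one_sub_pos (x : HypSpace) : 0 < 1 - ‖x.coord‖ ^ 2 := by
  nlinarith [x.norm_lt_one, norm_nonneg x.coord]

theorem inner_lt_one (x y : HypSpace) : ⟪x.coord, y.coord⟫_ℝ < 1 := by
  have h := real_inner_le_norm x.coord y.coord
  nlinarith [x.norm_lt_one, norm_nonneg x.coord, y.norm_lt_one, norm_nonneg y.coord]

theorem coshDist_comm (x y : HypSpace) : coshDist x y = coshDist y x := by
  unfold coshDist
  rw [real_inner_comm, mul_comm]

theorem coshDist_pos (x y : HypSpace) : 0 < coshDist x y := by
  have := inner_lt_one x y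
  exact div_pos (by linarith)
    (mul_pos (Real.sqrt_pos.2 (one_sub_pos x)) (Real.sqrt_pos.2 (one_sub_pos y)))

theorem coshDist_sq (x y : HypSpace) : coshDist x y ^ 2 =
    (1 - ⟪x.coord, y.coord⟫_ℝ) ^ 2 / ((1 - ‖x.coord‖ ^ 2) * (1 - ‖y.coord‖ ^ 2)) := by
  rw [coshDist, div_pow, mul_pow, Real.sq_sqrt (one_sub_pos x).le,
    Real.sq_sqrt (one_sub_pos y).le]

/-- The numerator of `cosh² d(x, y) - 1`, rewritten in terms of `u = x - y`. -/
theorem gram_eq (x y : E3) :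
    (1 - ⟪x, y⟫_ℝ) ^ 2 - (1 - ‖x‖ ^ 2) * (1 - ‖y‖ ^ 2) =
      (1 - ‖y‖ ^ 2) * ‖x - y‖ ^ 2 + ⟪x - y, y⟫_ℝ ^ 2 := by
  rw [norm_sub_sq_real, inner_sub_left, real_inner_self_eq_norm_sq]
  ring

theorem gram_mixed_eq (x y z : E3) :
    (1 - ⟪x, y⟫_ℝ) * (1 - ⟪y, z⟫_ℝ) - (1 - ⟪x, z⟫_ℝ) * (1 - ‖y‖ ^ 2) =
      (1 - ‖y‖ ^ 2) * ⟪x - y, z - y⟫_ℝ + ⟪x - y, y⟫_ℝ * ⟪z - y, y⟫_ℝ := by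
  simp only [inner_sub_left, inner_sub_right, real_inner_self_eq_norm_sq]
  rw [real_inner_comm y z]
  ring

theorem one_le_coshDist (x y : HypSpace) : 1 ≤ coshDist x y := by
  have h1 : 1 ≤ coshDist x y ^ 2 := by
    rw [coshDist_sq, one_le_div (mul_pos (one_sub_pos x) (one_sub_pos y))]
    have := gram_eq x.coord y.coord
    have := one_sub_pos y
    nlinarith [mul_nonneg this.le (sq_nonneg ‖x.coord - y.coord‖),
      sq_nonneg ⟪x.coord - y.coord, y.coord⟫_ℝ]
  nlinarith [coshDist_pos x y]

theorem coshDist_self (x : HypSpace) : coshDist x x = 1 := by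
  rw [coshDist, real_inner_self_eq_norm_sq, Real.mul_self_sqrt (one_sub_pos x).le,
    div_self (one_sub_pos x).ne']

theorem eq_of_coshDist_eq_one {x y : HypSpace} (h : coshDist x y = 1) : x = y := by
  have h1 := coshDist_sq x y
  rw [h, one_pow, eq_comm, div_eq_one_iff_eq
    (mul_pos (one_sub_pos x) (one_sub_pos y)).ne'] at h1
  have h2 := gram_eq x.coord y.coord
  have h3 := one_sub_pos y
  have h4 : (1 - ‖y.coord‖ ^ 2) * ‖x.coord - y.coord‖ ^ 2 = 0 := by
    nlinarith [mul_nonneg h3.le (sq_nonneg ‖x.coord - y.coord‖),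
      sq_nonneg ⟪x.coord - y.coord, y.coord⟫_ℝ]
  have h5 : ‖x.coord - y.coord‖ = 0 := by
    rcases mul_eq_zero.1 h4 with h6 | h6
    · exact absurd h6 h3.ne'
    · exact pow_eq_zero_iff (two_ne_zero) |>.1 h6
  exact HypSpace.ext (sub_eq_zero.1 (norm_eq_zero.1 h5))

/-- The Cauchy-Schwarz inequality for the form `b ⟪u, v⟫ + ⟪u, y⟫ ⟪v, y⟫`. -/
theorem gram_cauchy_schwarz (u v y : E3) {b : ℝ} (hb : 0 ≤ b) :
    (b * ⟪u, v⟫_ℝ + ⟪u, y⟫_ℝ * ⟪v, y⟫_ℝ) ^ 2 ≤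
      (b * ‖u‖ ^ 2 + ⟪u, y⟫_ℝ ^ 2) * (b * ‖v‖ ^ 2 + ⟪v, y⟫_ℝ ^ 2) := by
  set p := ⟪u, y⟫_ℝ
  set q := ⟪v, y⟫_ℝ
  have h1 : ⟪u, v⟫_ℝ ^ 2 ≤ ‖u‖ ^ 2 * ‖v‖ ^ 2 := by
    rw [← mul_pow]
    exact sq_le_sq.2 (by
      rw [abs_of_nonneg (mul_nonneg (norm_nonneg u) (norm_nonneg v))]
      exact abs_real_inner_le_norm u v)
  have h2 : 0 ≤ ‖q • u - p • v‖ ^ 2 := sq_nonneg _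
  rw [norm_sub_sq_real, norm_smul, norm_smul, inner_smul_left, inner_smul_right, mul_pow,
    mul_pow, Real.norm_eq_abs, Real.norm_eq_abs, sq_abs, sq_abs] at h2
  simp only [conj_trivial] at h2
  nlinarith [mul_nonneg hb h2, mul_le_mul_of_nonneg_left h1 (mul_nonneg hb hb)]

theorem coshDist_triangle (x y z : HypSpace) :
    coshDist x z ≤ coshDist x y * coshDist y z +
      √(coshDist x y ^ 2 - 1) * √(coshDist y z ^ 2 - 1) := by
  have ha := one_sub_pos x
  have hb := one_sub_pos y
  have hc := one_sub_pos z
  have hsa := Real.sqrt_pos.2 ha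
  have hsb := Real.sqrt_pos.2 hb
  have hsc := Real.sqrt_pos.2 hc
  have key : (coshDist x y * coshDist y z - coshDist x z) ^ 2 ≤
      (coshDist x y ^ 2 - 1) * (coshDist y z ^ 2 - 1) := by
    have e1 : coshDist x y * coshDist y z - coshDist x z =
        ((1 - ⟪x.coord, y.coord⟫_ℝ) * (1 - ⟪y.coord, z.coord⟫_ℝ) -
          (1 - ⟪x.coord, z.coord⟫_ℝ) * (1 - ‖y.coord‖ ^ 2)) /
          ((1 - ‖y.coord‖ ^ 2) * (√(1 - ‖x.coord‖ ^ 2) * √(1 - ‖z.coord‖ ^ 2))) := by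
      have hs : 1 - ‖y.coord‖ ^ 2 = √(1 - ‖y.coord‖ ^ 2) * √(1 - ‖y.coord‖ ^ 2) :=
        (Real.mul_self_sqrt hb.le).symm
      unfold coshDist
      rw [eq_div_iff (mul_pos hb (mul_pos hsa hsc)).ne']
      conv_lhs => rw [hs]
      conv_rhs => rw [hs]
      rw [Real.sqrt_mul_self (Real.sqrt_nonneg _)]
      field_simp
    have e2 : coshDist x y ^ 2 - 1 = ((1 - ‖y.coord‖ ^ 2) * ‖x.coord - y.coord‖ ^ 2 +
        ⟪x.coord - y.coord, y.coord⟫_ℝ ^ 2) / ((1 - ‖x.coord‖ ^ 2) * (1 - ‖y.coord‖ ^ 2)) := by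
      rw [coshDist_sq, ← gram_eq, sub_div, div_self (mul_pos ha hb).ne']
    have e3 : coshDist y z ^ 2 - 1 = ((1 - ‖y.coord‖ ^ 2) * ‖z.coord - y.coord‖ ^ 2 +
        ⟪z.coord - y.coord, y.coord⟫_ℝ ^ 2) / ((1 - ‖z.coord‖ ^ 2) * (1 - ‖y.coord‖ ^ 2)) := by
      rw [coshDist_comm, coshDist_sq, ← gram_eq, sub_div, div_self (mul_pos hc hb).ne']
    rw [e1, e2, e3, gram_mixed_eq, div_pow, div_mul_div_comm, mul_pow, mul_pow,
      Real.sq_sqrt ha.le, Real.sq_sqrt hc.le]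
    have e4 : (1 - ‖x.coord‖ ^ 2) * (1 - ‖y.coord‖ ^ 2) *
        ((1 - ‖z.coord‖ ^ 2) * (1 - ‖y.coord‖ ^ 2)) =
        (1 - ‖y.coord‖ ^ 2) ^ 2 * ((1 - ‖x.coord‖ ^ 2) * (1 - ‖z.coord‖ ^ 2)) := by ring
    rw [e4]
    exact div_le_div_of_nonneg_right (gram_cauchy_schwarz _ _ _ hb.le) (by positivity)
  have h1 : 0 ≤ coshDist x y ^ 2 - 1 := by nlinarith [one_le_coshDist x y]
  rw [← Real.sqrt_mul h1]
  have h2 := Real.abs_le_sqrt key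
  linarith [neg_abs_le (coshDist x y * coshDist y z - coshDist x z)]

/-- The hyperbolic metric; the topology of `HypSpace` is the metric topology. -/
noncomputable instance instMetricSpace : MetricSpace HypSpace where
  dist_self x := by rw [dist_def, coshDist_self, Real.arcosh_zero]
  dist_comm x y := by rw [dist_def, dist_def, coshDist_comm]
  dist_triangle x y z := by
    have h1 := Real.arcosh_nonneg (one_le_coshDist x y)
    have h2 := Real.arcosh_nonneg (one_le_coshDist y z)
    rw [dist_def, dist_def, dist_def, ← Real.arcosh_cosh (add_nonneg h1 h2),
      Real.arcosh_le_arcosh (coshDist_pos x z) (Real.cosh_pos _), Real.cosh_add,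
      Real.cosh_arcosh (one_le_coshDist x y), Real.cosh_arcosh (one_le_coshDist y z),
      Real.sinh_arcosh (one_le_coshDist x y), Real.sinh_arcosh (one_le_coshDist y z)]
    exact coshDist_triangle x y z
  eq_of_dist_eq_zero {x y} h := by
    rw [dist_def, Real.arcosh_eq_zero_iff (one_le_coshDist x y)] at h
    exact eq_of_coshDist_eq_one h

/-- Convexity in hyperbolic space: the hyperbolic geodesic segments of the Klein model are the
Euclidean segments, so a set is convex when its set of coordinates is. -/
def IsConvex (K : Set HypSpace) : Prop := Convex ℝ (coord '' K)

/-- The accumulation set at infinity of a subset of hyperbolic space. -/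
def accumulationAtInfinity (K : Set HypSpace) : Set SphereAtInfinity :=
  {p | (p : E3) ∈ closure (coord '' K)}

/-- `CH(C)`: the smallest closed convex subset of hyperbolic space whose accumulation set at
infinity is `C`. -/
def hull (C : Set SphereAtInfinity) : Set HypSpace :=
  ⋂₀ {K | IsClosed K ∧ IsConvex K ∧ accumulationAtInfinity K = C}

/-- The complementary components of `CH(C)` in hyperbolic space. For a Jordan curve `C` there are
exactly two, one facing each of the two discs bounded by `C` in the sphere at infinity. -/
def IsHullSide (C : Set SphereAtInfinity) (U : Set HypSpace) : Prop :=
  ∃ p ∈ (hull C)ᶜ, U = connectedComponentIn (hull C)ᶜ p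

/-- `Sp` and `Sm` are the two boundary surfaces `∂⁺CH(C)` and `∂⁻CH(C)` (in some order): the
frontiers of the two complementary components of `CH(C)`. If `C` is a round circle then `CH(C)` is
a plane, and both surfaces are that plane. -/
def IsBoundaryPair (C : Set SphereAtInfinity) (Sp Sm : Set HypSpace) : Prop :=
  ∃ Up Um : Set HypSpace, IsHullSide C Up ∧ IsHullSide C Um ∧ Up ≠ Um ∧
    Sp = frontier Up ∧ Sm = frontier Um

end HypSpace

/-- A Jordan curve in the sphere at infinity: the image of an injective continuous map from the
circle. -/
def IsJordanCurve (C : Set SphereAtInfinity) : Prop :=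
  ∃ γ : Circle → SphereAtInfinity, Continuous γ ∧ Function.Injective γ ∧ range γ = C

/-- The boundary width, as a function of the two boundary surfaces. -/
noncomputable def boundaryWidth (Sp Sm : Set HypSpace) : ℝ≥0∞ :=
  max (⨆ x ∈ Sp, infEDist x Sm) (⨆ x ∈ Sm, infEDist x Sp)

/-- `f` is a nearest-point projection from `S` to `T`: each `f x` is one of the points of `T`
nearest to `x`. -/
def IsNearestPointProjection {S T : Set HypSpace} (f : S → T) : Prop :=
  ∀ x : S, edist (x : HypSpace) (f x : HypSpace) = infEDist (x : HypSpace) T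

/-- The induced path metric of a metric space: the infimum of the lengths of the paths joining two
points. -/
noncomputable def pathEDist {X : Type*} [MetricSpace X] (x y : X) : ℝ≥0∞ :=
  ⨅ γ : Path x y, eVariationOn γ univ

/-- `f` is an `(L, A)`-quasi-isometry with respect to the path metrics: an `(L, A)`-quasi-isometric
embedding whose image is `A`-dense. -/
structure IsQuasiIsometryWith {X Y : Type*} [MetricSpace X] [MetricSpace Y] (L A : ℝ≥0)
    (f : X → Y) : Prop where
  upper : ∀ x x' : X, pathEDist (f x) (f x') ≤ L * pathEDist x x' + A
  lower : ∀ x x' : X, (L : ℝ≥0∞)⁻¹ * pathEDist x x' - A ≤ pathEDist (f x) (f x')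
  dense : ∀ y : Y, ∃ x : X, pathEDist y (f x) ≤ A

/-- `f` and `g` are quasi-inverse to each other with constant `A`, with respect to the path
metrics: both compositions are within distance `A` of the identity. -/
def IsQuasiInverseWith {X Y : Type*} [MetricSpace X] [MetricSpace Y] (A : ℝ≥0)
    (f : X → Y) (g : Y → X) : Prop :=
  (∀ x : X, pathEDist (g (f x)) x ≤ A) ∧ (∀ y : Y, pathEDist (f (g y)) y ≤ A)

/-!
Let `U` and `V` be the two complementary components of the hull whose frontiers are the boundary
surfaces. Each is a union of open half-spaces, since a half-space that separates a point from the
hull is connected; so `U` and `V` are disjoint open sets with convex complements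
(`IsHullSide.exists_halfSpace`, `IsHullSide.isConvex_compl`). In the hyperboloid model a half-space
is `{z | 0 < mink (lift z) n}` for a unit normal `n`, and every point of the frontier of `U` has a
supporting plane whose open half-space lies in `U`.

The heart of the proof is local. Let `y` be on the frontier of `V`, with supporting normal `m`, and
let `x`, `x'` be on the frontier of `U`, with supporting normals `n`, `n'`, at distance at most `d`
from `y`. The half-spaces of `n` and `m` are disjoint, as are those of `n'` and `m`, so `mink n m ≤
-1` and `mink n' m ≤ -1`. The planes of `n` and `n'` pass within `d` of `y`, so, seen from `y`,
both normals make an angle of cosine at least `1 / cosh d` with `-m`, and the Cauchy-Schwarz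
inequality in the orthogonal complements of `y` and `m` gives `mink n n' ≥ 1 - 2 sinh² d`
(`one_sub_le_mink_normals`). If `d < arcosh √2`, then `sinh d < 1` and the bound exceeds `-1`: the
half-spaces of `n` and `n'` meet, at a bounded distance from `y`. The geodesics from `x` and `x'`
to a common point stay in the closure of `U`, and the nearest-point retraction onto the complement
of `U`, which is `1`-Lipschitz, carries them to a path of bounded length on the frontier of `U`
(`pathEDist_frontier_le`).

Take `d` strictly between `w` and `arcosh √2`. By the local estimate the projections are coarsely
inverse to each other, and they move points at distance at most `d - w` to points at bounded path
distance. Cutting a path greedily into steps of that size bounds the path distances of images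
linearly (`pathEDist_map_le`), and coarse invertibility gives the lower bound and the density of
the image (`isQuasiIsometryWith_of_coarse_inverse`).
-/

namespace HypSpace

/-! ### The Minkowski form and the hyperboloid -/

/-- The Minkowski form of signature `(3, 1)` on `ℝ × E3`, negative on the first factor. -/
noncomputable def mink (a b : ℝ × E3) : ℝ := ⟪a.2, b.2⟫_ℝ - a.1 * b.1

theorem mink_comm (a b : ℝ × E3) : mink a b = mink b a := by
  simp only [mink, real_inner_comm, mul_comm]

theorem mink_add_left (a b c : ℝ × E3) : mink (a + b) c = mink a c + mink b c := by
  simp only [mink, Prod.fst_add, Prod.snd_add, inner_add_left]; ring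

theorem mink_add_right (a b c : ℝ × E3) : mink a (b + c) = mink a b + mink a c := by
  simp only [mink, Prod.fst_add, Prod.snd_add, inner_add_right]; ring

theorem mink_sub_left (a b c : ℝ × E3) : mink (a - b) c = mink a c - mink b c := by
  simp only [mink, Prod.fst_sub, Prod.snd_sub, inner_sub_left]; ring

theorem mink_sub_right (a b c : ℝ × E3) : mink a (b - c) = mink a b - mink a c := by
  simp only [mink, Prod.fst_sub, Prod.snd_sub, inner_sub_right]; ring

theorem mink_smul_left (r : ℝ) (a b : ℝ × E3) : mink (r • a) b = r * mink a b := by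
  simp only [mink, Prod.smul_fst, Prod.smul_snd, real_inner_smul_left, smul_eq_mul]; ring

theorem mink_smul_right (r : ℝ) (a b : ℝ × E3) : mink a (r • b) = r * mink a b := by
  simp only [mink, Prod.smul_fst, Prod.smul_snd, real_inner_smul_right, smul_eq_mul]; ring

/-- The Minkowski form is positive semidefinite on the orthogonal complement of a timelike
vector. -/
theorem mink_self_nonneg_of_orthogonal {a u : ℝ × E3} (ha : mink a a < 0) (hu : mink a u = 0) :
    0 ≤ mink u u := by
  simp only [mink, real_inner_self_eq_norm_sq] at *
  have h1 : ⟪a.2, u.2⟫_ℝ ^ 2 ≤ ‖a.2‖ ^ 2 * ‖u.2‖ ^ 2 := by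
    rw [← mul_pow, sq_le_sq, abs_of_nonneg (by positivity : 0 ≤ ‖a.2‖ * ‖u.2‖)]
    exact abs_real_inner_le_norm _ _
  have h2 : ⟪a.2, u.2⟫_ℝ = a.1 * u.1 := by linarith
  rw [h2] at h1
  have h3 : 0 < a.1 ^ 2 := by nlinarith [sq_nonneg ‖a.2‖]
  by_contra! h4
  nlinarith [mul_le_mul_of_nonneg_right (by linarith : ‖a.2‖ ^ 2 ≤ a.1 ^ 2) (sq_nonneg ‖u.2‖)]

/-- The Cauchy-Schwarz inequality on the orthogonal complement of a timelike vector. -/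
theorem mink_le_mul_of_orthogonal {a u v : ℝ × E3} (ha : mink a a < 0) (hu : mink a u = 0)
    (hv : mink a v = 0) {A B : ℝ} (hA : 0 ≤ A) (hB : 0 ≤ B) (huA : mink u u ≤ A ^ 2)
    (hvB : mink v v ≤ B ^ 2) : |mink u v| ≤ A * B := by
  have h1 : discrim (mink v v) (2 * mink u v) (mink u u) ≤ 0 := by
    refine discrim_le_zero fun t => ?_
    have := mink_self_nonneg_of_orthogonal (u := u + t • v) ha
      (by rw [mink_add_right, mink_smul_right, hu, hv]; ring)
    simp only [mink_add_left, mink_add_right, mink_smul_left, mink_smul_right] at this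
    rw [mink_comm v u] at this
    linarith
  have h2 := mink_self_nonneg_of_orthogonal ha hv
  have h3 : mink u v ^ 2 ≤ (A * B) ^ 2 := by
    rw [mul_pow]
    rw [discrim] at h1
    nlinarith [mul_le_mul huA hvB h2 (sq_nonneg A)]
  exact abs_le_of_sq_le_sq h3 (mul_nonneg hA hB)

/-- The point of the hyperboloid over a point of the Klein model. -/
noncomputable def lift (x : HypSpace) : ℝ × E3 :=
  ((√(1 - ‖x.coord‖ ^ 2))⁻¹, (√(1 - ‖x.coord‖ ^ 2))⁻¹ • x.coord)

theorem cosh_dist (x y : HypSpace) : Real.cosh (dist x y) = coshDist x y := by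
  rw [dist_def, Real.cosh_arcosh (one_le_coshDist x y)]

theorem mink_lift_lift (x y : HypSpace) : mink (lift x) (lift y) = -Real.cosh (dist x y) := by
  have hx := (Real.sqrt_pos.2 (one_sub_pos x)).ne'
  have hy := (Real.sqrt_pos.2 (one_sub_pos y)).ne'
  rw [cosh_dist, coshDist, mink, lift, lift, real_inner_smul_left, real_inner_smul_right]
  field_simp
  ring

theorem mink_lift_self (x : HypSpace) : mink (lift x) (lift x) = -1 := by
  rw [mink_lift_lift, dist_self, Real.cosh_zero]

theorem mink_lift_self_neg (x : HypSpace) : mink (lift x) (lift x) < 0 := by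
  rw [mink_lift_self]; norm_num

/-- The Minkowski product with a lift, up to a positive factor, is an affine function of the
coordinate in the Klein model. -/
theorem mink_lift (x : HypSpace) (n : ℝ × E3) :
    mink (lift x) n = (√(1 - ‖x.coord‖ ^ 2))⁻¹ * (⟪x.coord, n.2⟫_ℝ - n.1) := by
  rw [mink, lift, real_inner_smul_left]; ring

theorem mink_lift_pos_iff {x : HypSpace} {n : ℝ × E3} :
    0 < mink (lift x) n ↔ 0 < ⟪x.coord, n.2⟫_ℝ - n.1 := by
  rw [mink_lift, mul_pos_iff_of_pos_left (inv_pos.2 (Real.sqrt_pos.2 (one_sub_pos x)))]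

theorem mink_lift_nonneg_iff {x : HypSpace} {n : ℝ × E3} :
    0 ≤ mink (lift x) n ↔ 0 ≤ ⟪x.coord, n.2⟫_ℝ - n.1 := by
  rw [mink_lift, mul_nonneg_iff_of_pos_left (inv_pos.2 (Real.sqrt_pos.2 (one_sub_pos x)))]

/-- A timelike vector in the time cone of the hyperboloid is a positive multiple of a lift. -/
theorem exists_lift_eq_smul (y : HypSpace) {v : ℝ × E3} (hv : mink v v < 0)
    (hy : mink (lift y) v < 0) : ∃ z : HypSpace, lift z = (√(-mink v v))⁻¹ • v := by
  have hv' : ‖v.2‖ ^ 2 < v.1 ^ 2 := by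
    rw [mink, real_inner_self_eq_norm_sq] at hv; linarith
  have h0 : 0 < v.1 := by
    by_contra! h
    refine absurd hy (not_lt.2 (mink_lift_nonneg_iff.2 ?_))
    have h1 : ‖v.2‖ ≤ -v.1 := by
      rw [← abs_of_nonpos h]; exact (abs_le_of_sq_le_sq' (by rw [sq_abs]; exact hv'.le)
        (abs_nonneg _)).2
    have h2 := neg_le_of_abs_le (abs_real_inner_le_norm y.coord v.2)
    nlinarith [mul_le_mul_of_nonneg_right y.norm_lt_one.le (norm_nonneg v.2)]
  have h1 : ‖v.1⁻¹ • v.2‖ < 1 := by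
    rw [norm_smul, Real.norm_of_nonneg (inv_nonneg.2 h0.le), inv_mul_lt_one₀ h0]
    exact lt_of_pow_lt_pow_left₀ 2 h0.le hv'
  have h2 : √(1 - ‖v.1⁻¹ • v.2‖ ^ 2) = √(-mink v v) / v.1 := by
    rw [norm_smul, Real.norm_of_nonneg (inv_nonneg.2 h0.le), ← Real.sqrt_sq h0.le,
      ← Real.sqrt_div (by linarith), Real.sqrt_sq h0.le, mink, real_inner_self_eq_norm_sq]
    congr 1
    field_simp
    ring
  refine ⟨⟨v.1⁻¹ • v.2, h1⟩, ?_⟩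
  have h3 : √(-mink v v) ≠ 0 := (Real.sqrt_pos.2 (by linarith)).ne'
  rw [lift, h2]
  ext1
  · simp [div_eq_inv_mul]
  · simp only [Prod.smul_snd, smul_smul]
    congr 1
    field_simp

/-- The distance of a point from a plane is at most its distance from a point of the plane. -/
theorem abs_mink_lift_le_sinh_dist {x y : HypSpace} {n : ℝ × E3} (hn : mink n n = 1)
    (hx : mink (lift x) n = 0) : |mink (lift y) n| ≤ Real.sinh (dist x y) := by
  have h := mink_le_mul_of_orthogonal (u := lift y - Real.cosh (dist x y) • lift x) (v := n)
    (A := Real.sinh (dist x y)) (B := 1)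
    (mink_lift_self_neg x)
    (by rw [mink_sub_right, mink_smul_right, mink_lift_self, mink_lift_lift]; ring) hx
    (Real.sinh_nonneg_iff.2 dist_nonneg) zero_le_one
    (by
      simp only [mink_sub_left, mink_sub_right, mink_smul_left, mink_smul_right, mink_lift_self,
        mink_lift_lift, dist_comm y x]
      nlinarith [Real.cosh_sq (dist x y)])
    (by rw [hn]; norm_num)
  rwa [mink_sub_left, mink_smul_left, hx, mul_zero, sub_zero, mul_one] at h

/-! ### The topology of the Klein model -/

theorem norm_coord_sub_le_sinh_dist (x y : HypSpace) :
    ‖x.coord - y.coord‖ ≤ Real.sinh (dist x y) := by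
  have hx := one_sub_pos x
  have hy := one_sub_pos y
  refine (abs_le_of_sq_le_sq' ?_ (Real.sinh_nonneg_iff.2 dist_nonneg)).2
  have h1 : Real.sinh (dist x y) ^ 2 = coshDist x y ^ 2 - 1 := by
    rw [← cosh_dist, Real.cosh_sq]; ring
  rw [h1, coshDist_sq, le_sub_iff_add_le, le_div_iff₀ (by positivity)]
  have h2 := gram_eq x.coord y.coord
  nlinarith [sq_nonneg ⟪x.coord - y.coord, y.coord⟫_ℝ, mul_nonneg (mul_nonneg
    (sq_nonneg ‖x.coord‖) hy.le) (sq_nonneg ‖x.coord - y.coord‖)]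

theorem isInducing_coord : Topology.IsInducing coord := by
  rw [Topology.isInducing_iff_nhds]
  intro x
  refine le_antisymm ?_ ?_
  · rw [← Filter.tendsto_iff_comap, tendsto_iff_norm_sub_tendsto_zero]
    refine squeeze_zero (fun _ => norm_nonneg _) (fun y => norm_coord_sub_le_sinh_dist y x) ?_
    have h : Filter.Tendsto (fun y => Real.sinh (dist y x)) (nhds x)
        (nhds (Real.sinh (dist x x))) :=
      (Real.continuous_sinh.comp (continuous_id.dist continuous_const)).tendsto x
    simpa using h
  · -- near `x` the distance to `x` is a continuous function of the coordinate
    have hs := Real.sqrt_pos.2 (one_sub_pos x)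
    have h1 : ContinuousAt (fun u : E3 => (1 - ⟪u, x.coord⟫_ℝ) /
        (√(1 - ‖u‖ ^ 2) * √(1 - ‖x.coord‖ ^ 2))) x.coord :=
      ContinuousAt.div (by fun_prop) (by fun_prop) (mul_pos hs hs).ne'
    have h2 : Filter.Tendsto (fun y => coshDist y x)
        (Filter.comap coord (nhds x.coord)) (nhds 1) := by
      have h3 := h1.tendsto.comp (Filter.tendsto_comap (f := coord))
      have h4 := coshDist_self x
      rw [coshDist] at h4
      rw [h4] at h3
      exact h3
    have h5 : Filter.Tendsto (fun y => dist y x)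
        (Filter.comap coord (nhds x.coord)) (nhds 0) := by
      have h6 : Filter.Tendsto Real.arcosh (nhdsWithin 1 (Ici 1)) (nhds 0) := by
        simpa using (Real.continuousOn_arcosh 1 (mem_Ici.2 le_rfl)).tendsto
      exact h6.comp (tendsto_nhdsWithin_iff.2
        ⟨h2, Filter.Eventually.of_forall fun y => one_le_coshDist y x⟩)
    rw [← Filter.tendsto_id']
    exact tendsto_iff_dist_tendsto_zero.2 h5

theorem range_coord : range coord = ball (0 : E3) 1 := by
  ext u
  simp only [mem_range, mem_ball_zero_iff]
  exact ⟨fun ⟨x, hx⟩ => hx ▸ x.norm_lt_one, fun h => ⟨⟨u, h⟩, rfl⟩⟩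

theorem isOpenEmbedding_coord : Topology.IsOpenEmbedding coord where
  toIsInducing := isInducing_coord
  injective _ _ h := HypSpace.ext h
  isOpen_range := by rw [range_coord]; exact isOpen_ball

theorem continuous_mink_lift (n : ℝ × E3) : Continuous fun x => mink (lift x) n := by
  have h := isInducing_coord.continuous
  simp only [mink_lift]
  exact (Continuous.inv₀ (by fun_prop) fun x => (Real.sqrt_pos.2 (one_sub_pos x)).ne').mul
    (by fun_prop)

instance : ProperSpace HypSpace := by
  refine .of_isCompact_closedBall_of_le 0 fun x R _ => ?_
  have hx := Real.sqrt_pos.2 (one_sub_pos x)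
  set s := √(1 - ‖x.coord‖ ^ 2) with hs
  -- the image of the ball in the Klein model stays away from the unit sphere
  set K : Set E3 := {u | ‖u‖ ≤ 1 ∧ 1 - ⟪x.coord, u⟫_ℝ ≤ Real.cosh R * (s * √(1 - ‖u‖ ^ 2))}
    with hK
  have hKc : IsCompact K := by
    have h1 : IsClosed {u : E3 | 1 - ⟪x.coord, u⟫_ℝ ≤ Real.cosh R * (s * √(1 - ‖u‖ ^ 2))} :=
      isClosed_le (by fun_prop) (by fun_prop)
    have h2 : IsClosed {u : E3 | ‖u‖ ≤ 1} := isClosed_le continuous_norm continuous_const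
    exact (isCompact_closedBall (0 : E3) 1).of_isClosed_subset (h2.inter h1)
      fun u hu => mem_closedBall_zero_iff.2 hu.1
  have hKr : K ⊆ range coord := by
    intro u hu
    rw [range_coord, mem_ball_zero_iff]
    refine lt_of_le_of_ne hu.1 fun h1 => ?_
    have h2 := hu.2
    rw [h1] at h2
    norm_num at h2
    have h3 := real_inner_le_norm x.coord u
    rw [h1] at h3
    linarith [x.norm_lt_one]
  have hpre : closedBall x R = coord ⁻¹' K := by
    ext y
    have hy := Real.sqrt_pos.2 (one_sub_pos y)
    have h1 : y.coord ∈ K ↔ coshDist x y ≤ Real.cosh R := by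
      rw [coshDist, div_le_iff₀ (mul_pos hx hy)]
      exact and_iff_right y.norm_lt_one.le
    rw [mem_preimage, h1, ← cosh_dist, mem_closedBall, Real.cosh_le_cosh, abs_of_nonneg dist_nonneg,
      abs_of_nonneg (by assumption), dist_comm]
  rw [hpre]
  exact (isInducing_coord.isCompact_preimage_iff hKr).2 hKc

/-! ### Convex sets, half-spaces and geodesics -/

theorem IsConvex.mem_of_lift_eq {K : Set HypSpace} (hK : IsConvex K) {a b z : HypSpace}
    (ha : a ∈ K) (hb : b ∈ K) {s t : ℝ} (hs : 0 ≤ s) (ht : 0 ≤ t)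
    (hz : lift z = s • lift a + t • lift b) : z ∈ K := by
  have pos : ∀ x : HypSpace, 0 < (lift x).1 := fun x =>
    inv_pos.2 (Real.sqrt_pos.2 (one_sub_pos x))
  have snd : ∀ x : HypSpace, (lift x).2 = (lift x).1 • x.coord := fun x => rfl
  have h1 : (lift z).1 = s * (lift a).1 + t * (lift b).1 := by rw [hz]; simp
  have h2 : (lift z).1 • z.coord = (s * (lift a).1) • a.coord + (t * (lift b).1) • b.coord := by
    rw [← snd, hz, mul_smul, mul_smul, ← snd, ← snd]; rfl
  have hz0 := pos z
  have h3 : z.coord = (s * (lift a).1 / (lift z).1) • a.coord +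
      (t * (lift b).1 / (lift z).1) • b.coord := by
    rw [div_eq_inv_mul, div_eq_inv_mul, mul_smul _ (s * _), mul_smul _ (t * _), ← smul_add, ← h2,
      inv_smul_smul₀ hz0.ne']
  have h4 : z.coord ∈ coord '' K := by
    rw [h3]
    exact hK (mem_image_of_mem _ ha) (mem_image_of_mem _ hb)
      (div_nonneg (mul_nonneg hs (pos a).le) hz0.le) (div_nonneg (mul_nonneg ht (pos b).le) hz0.le)
      (by rw [← add_div, ← h1, div_self hz0.ne'])
  exact isOpenEmbedding_coord.injective.mem_set_image.1 h4

/-- If an open half-space lies in `U`, the points of the closed half-space are in the closure of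
`U`. -/
theorem mem_closure_of_mink_nonneg {U : Set HypSpace} {n : ℝ × E3} (hn : n.2 ≠ 0)
    (hU : ∀ z, 0 < mink (lift z) n → z ∈ U) {p : HypSpace} (hp : 0 ≤ mink (lift p) n) :
    p ∈ closure U := by
  rw [isInducing_coord.closure_eq_preimage_closure_image, mem_preimage]
  have h1 : Filter.Tendsto (fun ε : ℝ => p.coord + ε • n.2) (nhdsWithin 0 (Ioi 0))
      (nhds p.coord) := by
    have : Continuous fun ε : ℝ => p.coord + ε • n.2 := by fun_prop
    simpa using (this.tendsto 0).mono_left nhdsWithin_le_nhds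
  refine mem_closure_of_tendsto h1 ?_
  have h2 : ball (0 : E3) 1 ∈ nhds p.coord :=
    isOpen_ball.mem_nhds (mem_ball_zero_iff.2 p.norm_lt_one)
  filter_upwards [h1 h2, self_mem_nhdsWithin] with ε hε hε0
  refine ⟨⟨p.coord + ε • n.2, mem_ball_zero_iff.1 hε⟩, hU _ (mink_lift_pos_iff.2 ?_), rfl⟩
  have h3 := mink_lift_nonneg_iff.1 hp
  have h4 : 0 < ‖n.2‖ := norm_pos_iff.2 hn
  have h5 : 0 < ε := hε0
  simp only [inner_add_left, real_inner_smul_left, real_inner_self_eq_norm_sq]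
  have : 0 < ε * ‖n.2‖ ^ 2 := by positivity
  linarith

theorem snd_ne_zero_of_mink_self_pos {n : ℝ × E3} (hn : 0 < mink n n) : n.2 ≠ 0 := by
  intro h
  rw [mink, h, inner_zero_left] at hn
  nlinarith [mul_self_nonneg n.1]

/-- Two points are joined by a geodesic, which stays in every closed half-space that contains
them. -/
theorem exists_geodesic (x z : HypSpace) : ∃ γ : ℝ → HypSpace, γ 0 = x ∧ γ 1 = z ∧
    (∀ s t, dist (γ s) (γ t) ≤ dist x z * |s - t|) ∧
    ∀ n, 0 ≤ mink (lift x) n → 0 ≤ mink (lift z) n →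
      ∀ t, 0 ≤ t → t ≤ 1 → 0 ≤ mink (lift (γ t)) n := by
  rcases eq_or_ne x z with rfl | hxz
  · exact ⟨fun _ => x, rfl, rfl, by simp, fun n hn _ _ _ _ => hn⟩
  set d := dist x z with hd
  have hd0 : 0 < d := dist_pos.2 hxz
  have hS : 0 < Real.sinh d := Real.sinh_pos_iff.2 hd0
  have hxx := mink_lift_self x
  have hzz := mink_lift_self z
  have hxz' := mink_lift_lift x z
  have hzx' : mink (lift z) (lift x) = -Real.cosh d := by rw [mink_comm, hxz']
  -- the point at time `t`, as a combination of the lifts of the end points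
  set c : ℝ → ℝ × E3 := fun t => (Real.sinh ((1 - t) * d) / Real.sinh d) • lift x +
    (Real.sinh (t * d) / Real.sinh d) • lift z with hc
  have hsub : ∀ t, Real.sinh ((1 - t) * d) =
      Real.sinh d * Real.cosh (t * d) - Real.cosh d * Real.sinh (t * d) := fun t => by
    rw [sub_mul, one_mul, Real.sinh_sub]
  have hcc : ∀ s t, mink (c s) (c t) = -Real.cosh ((s - t) * d) := by
    intro s t
    simp only [hc, mink_add_left, mink_add_right, mink_smul_left, mink_smul_right, hxx, hzz, hxz',
      hzx', hsub]
    rw [sub_mul, Real.cosh_sub]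
    have h := Real.cosh_sq d
    generalize s * d = a
    generalize t * d = b
    field_simp
    linear_combination (Real.sinh a * Real.sinh b) * h
  have h1 : ∀ t, mink (c t) (c t) = -1 := fun t => by rw [hcc]; simp
  have hc0 : c 0 = lift x := by simp [hc, hS.ne']
  have hc1 : c 1 = lift z := by simp [hc, hS.ne']
  have h2 : ∀ t, ∃ p : HypSpace, lift p = c t := by
    intro t
    obtain ⟨p, hp⟩ := exists_lift_eq_smul x (v := c t) (by rw [h1]; norm_num)
      (by rw [← hc0, hcc]; linarith [Real.cosh_pos ((0 - t) * d)])
    refine ⟨p, ?_⟩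
    rw [hp, h1]
    simp
  choose γ hγ using h2
  have hdist : ∀ s t, dist (γ s) (γ t) = d * |s - t| := by
    intro s t
    have h3 := mink_lift_lift (γ s) (γ t)
    rw [hγ, hγ, hcc, neg_inj] at h3
    have h4 := le_antisymm (Real.cosh_le_cosh.1 h3.ge) (Real.cosh_le_cosh.1 h3.le)
    rw [abs_of_nonneg dist_nonneg, abs_mul, abs_of_pos hd0] at h4
    rw [h4, mul_comm]
  have heq : ∀ {p q : HypSpace}, lift p = lift q → p = q := by
    intro p q h
    refine eq_of_dist_eq_zero ?_
    have h3 := mink_lift_lift p q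
    rw [h, mink_lift_self, neg_inj] at h3
    rw [← Real.arcosh_cosh (dist_nonneg (x := p) (y := q)), ← h3, Real.arcosh_zero]
  refine ⟨γ, heq ((hγ 0).trans hc0), heq ((hγ 1).trans hc1), fun s t => (hdist s t).le, ?_⟩
  intro n hx hz t ht0 ht1
  rw [hγ, hc, mink_add_left, mink_smul_left, mink_smul_left]
  have h3 : 0 ≤ Real.sinh ((1 - t) * d) :=
    Real.sinh_nonneg_iff.2 (mul_nonneg (by linarith) hd0.le)
  have h4 : 0 ≤ Real.sinh (t * d) := Real.sinh_nonneg_iff.2 (mul_nonneg ht0 hd0.le)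
  positivity

/-! ### The nearest-point retraction onto a closed convex set -/

/-- The first variation at a nearest point: the plane through the nearest point `a` of a convex set
`K`, orthogonal to the geodesic from `p`, supports `K`. -/
theorem IsConvex.mink_nearest_nonpos {K : Set HypSpace} (hK : IsConvex K) {p a b : HypSpace}
    (ha : a ∈ K) (hmin : ∀ c ∈ K, dist p a ≤ dist p c) (hb : b ∈ K) :
    mink (lift p - Real.cosh (dist p a) • lift a) (lift b) ≤ 0 := by
  set C := Real.cosh (dist p a) with hC
  have hC1 : 1 ≤ C := Real.one_le_cosh _
  rw [mink_sub_left, mink_smul_left, mink_lift_lift p b, mink_lift_lift a b]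
  set D := Real.cosh (dist p b)
  set c := Real.cosh (dist a b)
  have hD0 : 0 < D := Real.cosh_pos _
  have hc0 : 0 < c := Real.cosh_pos _
  have key : ∀ ε : ℝ, 0 < ε → 0 ≤ 2 * C * (D - C * c) + ε * (D ^ 2 - C ^ 2) := by
    intro ε hε
    -- the point over `a + ε b` is on the segment from `a` to `b`
    have hv : mink (lift a + ε • lift b) (lift a + ε • lift b) = -(1 + 2 * ε * c + ε ^ 2) := by
      simp only [mink_add_left, mink_add_right, mink_smul_left, mink_smul_right, mink_lift_self,
        mink_lift_lift, dist_comm b a]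
      ring
    have hpos : 0 < 1 + 2 * ε * c + ε ^ 2 := by positivity
    obtain ⟨z, hz⟩ := exists_lift_eq_smul a (v := lift a + ε • lift b) (by rw [hv]; linarith)
      (by rw [mink_add_right, mink_smul_right, mink_lift_self, mink_lift_lift]
          nlinarith [mul_pos hε hc0])
    rw [hv, neg_neg] at hz
    set N := √(1 + 2 * ε * c + ε ^ 2) with hN
    have hN0 : 0 < N := Real.sqrt_pos.2 hpos
    have hN2 : N ^ 2 = 1 + 2 * ε * c + ε ^ 2 := Real.sq_sqrt hpos.le
    have hzK : z ∈ K := hK.mem_of_lift_eq ha hb (s := N⁻¹) (t := N⁻¹ * ε) (by positivity)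
      (by positivity) (by rw [hz, smul_add, mul_smul])
    have h1 := Real.cosh_le_cosh.2 (by
      rw [abs_of_nonneg dist_nonneg, abs_of_nonneg dist_nonneg]; exact hmin z hzK :
        |dist p a| ≤ |dist p z|)
    have h2 := mink_lift_lift p z
    rw [hz, mink_smul_right, mink_add_right, mink_smul_right, mink_lift_lift p a,
      mink_lift_lift p b] at h2
    have h3 : C * N ≤ C + ε * D := by
      have h4 : Real.cosh (dist p z) = N⁻¹ * (C + ε * D) := by linarith
      rw [h4, inv_mul_eq_div, le_div_iff₀ hN0] at h1
      exact h1
    have h5 : (C * N) ^ 2 ≤ (C + ε * D) ^ 2 := pow_le_pow_left₀ (by positivity) h3 2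
    rw [mul_pow, hN2] at h5
    have h6 : 0 ≤ ε * (2 * C * (D - C * c) + ε * (D ^ 2 - C ^ 2)) := by linarith
    exact nonneg_of_mul_nonneg_right h6 hε
  have hlim : 0 ≤ 2 * C * (D - C * c) := by
    refine ge_of_tendsto (x := nhdsWithin (0 : ℝ) (Ioi 0))
      (f := fun ε => 2 * C * (D - C * c) + ε * (D ^ 2 - C ^ 2)) ?_ ?_
    · have : Continuous fun ε : ℝ => 2 * C * (D - C * c) + ε * (D ^ 2 - C ^ 2) := by fun_prop
      simpa using (this.tendsto 0).mono_left nhdsWithin_le_nhds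
    · filter_upwards [self_mem_nhdsWithin] with ε hε using key ε hε
  nlinarith [nonneg_of_mul_nonneg_right hlim (by positivity : 0 < 2 * C)]

/-- If `a` and `b` satisfy the first variation inequalities of nearest points to `p` and `q` with
respect to each other, then `a` and `b` are at most as far apart as `p` and `q`. -/
theorem dist_le_dist_of_mink_nonpos {p q a b : HypSpace}
    (hb : mink (lift p - Real.cosh (dist p a) • lift a) (lift b) ≤ 0)
    (ha : mink (lift q - Real.cosh (dist q b) • lift b) (lift a) ≤ 0) :
    dist a b ≤ dist p q := by
  set C := Real.cosh (dist p a) with hC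
  set C' := Real.cosh (dist q b) with hC'
  set S := Real.sinh (dist p a) with hS
  set S' := Real.sinh (dist q b) with hS'
  set P := lift p - C • lift a with hP
  set Q := lift q - C' • lift b with hQ
  have hC1 : 1 ≤ C := Real.one_le_cosh _
  have hC1' : 1 ≤ C' := Real.one_le_cosh _
  have hS0 : 0 ≤ S := Real.sinh_nonneg_iff.2 dist_nonneg
  have hS0' : 0 ≤ S' := Real.sinh_nonneg_iff.2 dist_nonneg
  have hCS : C ^ 2 = S ^ 2 + 1 := Real.cosh_sq _
  have hCS' : C' ^ 2 = S' ^ 2 + 1 := Real.cosh_sq _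
  set β := -mink (lift a) Q with hβ
  have hβ0 : 0 ≤ β := by rw [hβ, mink_comm]; linarith
  have hPa : mink (lift a) P = 0 := by
    rw [hP, mink_sub_right, mink_smul_right, mink_lift_self, mink_lift_lift, dist_comm a p]
    ring
  have hPP : mink P P = S ^ 2 := by
    simp only [hP, mink_sub_left, mink_sub_right, mink_smul_left, mink_smul_right, mink_lift_self,
      mink_lift_lift, dist_comm a p]
    linear_combination hCS
  have hQQ : mink Q Q = S' ^ 2 := by
    simp only [hQ, mink_sub_left, mink_sub_right, mink_smul_left, mink_smul_right, mink_lift_self,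
      mink_lift_lift, dist_comm b q]
    linear_combination hCS'
  -- project `Q` orthogonally to `a` and apply the Cauchy-Schwarz inequality
  have hcs := mink_le_mul_of_orthogonal (u := P) (v := Q - β • lift a) (A := S) (B := S' + β)
    (mink_lift_self_neg a) hPa
    (by rw [mink_sub_right, mink_smul_right, mink_lift_self, hβ]; ring) hS0 (by positivity) hPP.le
    (by
      have h : mink Q (lift a) = -β := by rw [mink_comm, hβ]; ring
      have h' : mink (lift a) Q = -β := by rw [hβ]; ring
      simp only [mink_sub_left, mink_sub_right, mink_smul_left, mink_smul_right, mink_lift_self,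
        hQQ, h, h']
      nlinarith [mul_nonneg hS0' hβ0])
  rw [mink_sub_right, mink_smul_right, mink_comm P (lift a), hPa, mul_zero, sub_zero] at hcs
  have hcs' := (abs_le.1 hcs).2
  have hpq : Real.cosh (dist p q) =
      C * C' * Real.cosh (dist a b) + C * β + C' * (-mink P (lift b)) - mink P Q := by
    have h1 : lift p = C • lift a + P := by rw [hP]; abel
    have h2 : lift q = C' • lift b + Q := by rw [hQ]; abel
    have h3 := mink_lift_lift p q
    rw [h1, h2] at h3
    simp only [mink_add_left, mink_add_right, mink_smul_left, mink_smul_right,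
      mink_lift_lift a b] at h3
    rw [hβ]
    linarith
  have hfin : Real.cosh (dist a b) ≤ Real.cosh (dist p q) := by
    have hc : 1 ≤ Real.cosh (dist a b) := Real.one_le_cosh _
    have hSC : S ≤ C := (abs_le_of_sq_le_sq' (by linarith) (by linarith)).2
    have h1 : 1 + S * S' ≤ C * C' := by
      refine (abs_le_of_sq_le_sq' ?_ (by positivity)).2
      rw [mul_pow, hCS, hCS']
      nlinarith [sq_nonneg (S - S')]
    have h2 : 0 ≤ C' * (-mink P (lift b)) := mul_nonneg (by linarith) (by linarith)
    rw [hpq]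
    nlinarith [mul_nonneg (sub_nonneg.2 hSC) hβ0, mul_nonneg hS0 hS0',
      mul_nonneg (sub_nonneg.2 hc) (by nlinarith [mul_nonneg hS0 hS0'] : 0 ≤ C * C' - 1)]
  rwa [Real.cosh_le_cosh, abs_of_nonneg dist_nonneg, abs_of_nonneg dist_nonneg] at hfin

/-- The nearest-point retraction onto the complement of an open set `U` with convex complement is
`1`-Lipschitz, and it maps the closure of `U` to the frontier of `U`. -/
theorem exists_lipschitz_retraction_frontier {U : Set HypSpace} (hU : IsOpen U)
    (hc : IsConvex Uᶜ) (hne : (Uᶜ).Nonempty) : ∃ r : HypSpace → HypSpace, LipschitzWith 1 r ∧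
      (∀ p ∈ closure U, r p ∈ frontier U) ∧ ∀ p ∈ Uᶜ, r p = p := by
  have h1 : ∀ p, ∃ a ∈ Uᶜ, ∀ c ∈ Uᶜ, dist p a ≤ dist p c := by
    intro p
    obtain ⟨a, ha, h⟩ := hU.isClosed_compl.exists_infDist_eq_dist hne p
    exact ⟨a, ha, fun c hc => h ▸ infDist_le_dist_of_mem hc⟩
  choose r hr hmin using h1
  have hfix : ∀ p ∈ Uᶜ, r p = p := fun p hp => by
    have h := hmin p p hp
    rw [dist_self] at h
    exact (dist_le_zero.1 h).symm
  refine ⟨r, LipschitzWith.mk_one fun p q => dist_le_dist_of_mink_nonpos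
    (hc.mink_nearest_nonpos (hr p) (hmin p) (hr q))
    (hc.mink_nearest_nonpos (hr q) (hmin q) (hr p)), ?_, hfix⟩
  intro p hp
  rw [hU.frontier_eq]
  refine ⟨?_, hr p⟩
  by_cases hpU : p ∈ U
  · -- the open half-space beyond the supporting plane at `r p` lies in `U`
    set n := lift p - Real.cosh (dist p (r p)) • lift (r p) with hn
    have hpr : p ≠ r p := fun h => hr p (h ▸ hpU)
    have hnn : mink n n = Real.sinh (dist p (r p)) ^ 2 := by
      simp only [hn, mink_sub_left, mink_sub_right, mink_smul_left, mink_smul_right,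
        mink_lift_self, mink_lift_lift, dist_comm (r p) p]
      linear_combination Real.cosh_sq (dist p (r p))
    have hpos : 0 < Real.sinh (dist p (r p)) := Real.sinh_pos_iff.2 (dist_pos.2 hpr)
    refine mem_closure_of_mink_nonneg (n := n)
      (snd_ne_zero_of_mink_self_pos (by rw [hnn]; positivity)) ?_ ?_
    · intro z hz
      by_contra hzU
      have := hc.mink_nearest_nonpos (hr p) (hmin p) hzU
      rw [mink_comm] at hz
      exact absurd hz (not_lt.2 this)
    · rw [hn, mink_sub_right, mink_smul_right, mink_lift_self, mink_lift_lift, dist_comm (r p) p]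
      linarith
  · rwa [hfix p hpU]

/-! ### Supporting planes -/

/-- A supporting plane at a frontier point of an open set with convex complement, given by its
unit normal pointing into the open set. -/
theorem exists_unit_normal {U : Set HypSpace} (hc : IsConvex Uᶜ)
    (hint : (interior Uᶜ).Nonempty) {x : HypSpace} (hx : x ∈ frontier U) :
    ∃ n : ℝ × E3, mink n n = 1 ∧ mink (lift x) n = 0 ∧ ∀ z, 0 < mink (lift z) n → z ∈ U := by
  have h1 : interior (coord '' Uᶜ) = coord '' interior Uᶜ := by
    refine subset_antisymm (fun u hu => ?_)
      (isOpenEmbedding_coord.isOpenMap.image_interior_subset _)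
    obtain ⟨y, -, rfl⟩ := interior_subset hu
    refine mem_image_of_mem _ (mem_interior.2 ⟨coord ⁻¹' interior (coord '' Uᶜ), fun z hz => ?_,
      isOpen_interior.preimage isOpenEmbedding_coord.continuous, hu⟩)
    exact isOpenEmbedding_coord.injective.mem_set_image.1 (interior_subset hz)
  obtain ⟨f, hf0, hf⟩ := geometric_hahn_banach_of_nonempty_interior_point (x := x.coord) hc
    (by
      rw [h1, isOpenEmbedding_coord.injective.mem_set_image]
      rw [← frontier_compl] at hx
      exact hx.2)
    (by rw [h1]; exact hint.image _)
  set u : E3 := (InnerProductSpace.toDual ℝ E3).symm f with hu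
  have hfu : ∀ v, f v = ⟪v, u⟫_ℝ := fun v => by
    rw [real_inner_comm, hu, InnerProductSpace.toDual_symm_apply]
  have hu0 : 0 < ‖u‖ := by
    rw [norm_pos_iff, hu]
    simpa using hf0
  set n : ℝ × E3 := (⟪x.coord, u⟫_ℝ, u) with hn
  have hnn : 0 < mink n n := by
    have h2 : ⟪x.coord, u⟫_ℝ ^ 2 ≤ ‖x.coord‖ ^ 2 * ‖u‖ ^ 2 := by
      rw [← mul_pow, sq_le_sq, abs_of_nonneg (by positivity : 0 ≤ ‖x.coord‖ * ‖u‖)]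
      exact abs_real_inner_le_norm _ _
    simp only [mink, hn, real_inner_self_eq_norm_sq]
    nlinarith [mul_pos (one_sub_pos x) (pow_pos hu0 2)]
  have hs : 0 < √(mink n n) := Real.sqrt_pos.2 hnn
  refine ⟨(√(mink n n))⁻¹ • n, ?_, ?_, fun z hz => ?_⟩
  · rw [mink_smul_left, mink_smul_right, ← mul_assoc, ← mul_inv, Real.mul_self_sqrt hnn.le,
      inv_mul_cancel₀ hnn.ne']
  · rw [mink_smul_right, mink_lift]
    simp [hn]
  · rw [mink_smul_right, mul_pos_iff_of_pos_left (inv_pos.2 hs), mink_lift_pos_iff] at hz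
    by_contra hzU
    have h3 := hf z.coord (mem_image_of_mem _ hzU)
    rw [hfu, hfu] at h3
    simp only [hn] at hz
    linarith

/-! ### The sides of the convex hull -/

theorem isClosed_hull (C : Set SphereAtInfinity) : IsClosed (hull C) :=
  isClosed_sInter fun _ hK => hK.1

theorem isConvex_hull (C : Set SphereAtInfinity) : IsConvex (hull C) := by
  rintro _ ⟨a, ha, rfl⟩ _ ⟨b, hb, rfl⟩ s t hs ht hst
  have h1 : s • a.coord + t • b.coord ∈ ball (0 : E3) 1 :=
    (convex_ball 0 1) (mem_ball_zero_iff.2 a.norm_lt_one) (mem_ball_zero_iff.2 b.norm_lt_one)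
      hs ht hst
  refine ⟨⟨_, mem_ball_zero_iff.1 h1⟩, fun K hK => ?_, rfl⟩
  rw [← isOpenEmbedding_coord.injective.mem_set_image]
  exact hK.2.1 (mem_image_of_mem _ (ha K hK)) (mem_image_of_mem _ (hb K hK)) hs ht hst

theorem isPreconnected_halfSpace (n : ℝ × E3) :
    IsPreconnected {z : HypSpace | 0 < mink (lift z) n} := by
  rw [← isInducing_coord.isPreconnected_image]
  have h1 : coord '' {z : HypSpace | 0 < mink (lift z) n} =
      ball (0 : E3) 1 ∩ {u | n.1 < ⟪u, n.2⟫_ℝ} := by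
    ext u
    constructor
    · rintro ⟨z, hz, rfl⟩
      exact ⟨mem_ball_zero_iff.2 z.norm_lt_one, sub_pos.1 (mink_lift_pos_iff.1 hz)⟩
    · rintro ⟨hu, h⟩
      exact ⟨⟨u, mem_ball_zero_iff.1 hu⟩, mink_lift_pos_iff.2 (sub_pos.2 h), rfl⟩
  rw [h1]
  refine ((convex_ball 0 1).inter ?_).isPreconnected
  refine convex_halfSpace_gt ⟨fun x y => inner_add_left _ _ _, fun c x => ?_⟩ _
  rw [real_inner_smul_left, smul_eq_mul]

/-- A complementary component of the hull is a union of open half-spaces: a half-space that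
separates one of its points from the hull is connected. -/
theorem IsHullSide.exists_halfSpace {C : Set SphereAtInfinity} {U : Set HypSpace}
    (hU : IsHullSide C U) {p : HypSpace} (hp : p ∈ U) :
    ∃ n : ℝ × E3, 0 < mink (lift p) n ∧ ∀ z, 0 < mink (lift z) n → z ∈ U := by
  obtain ⟨p₀, hp₀, rfl⟩ := hU
  have hpC : p ∉ hull C := connectedComponentIn_subset _ _ hp
  have h1 : p.coord ∉ closure (coord '' hull C) := by
    rwa [← mem_preimage, ← isInducing_coord.closure_eq_preimage_closure_image,
      (isClosed_hull C).closure_eq]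
  obtain ⟨f, v, hf, hfp⟩ := geometric_hahn_banach_closed_point (isConvex_hull C).closure
    isClosed_closure h1
  set u : E3 := (InnerProductSpace.toDual ℝ E3).symm f with hu
  have hfu : ∀ v, f v = ⟪v, u⟫_ℝ := fun v => by
    rw [real_inner_comm, hu, InnerProductSpace.toDual_symm_apply]
  have hpn : 0 < mink (lift p) (v, u) := mink_lift_pos_iff.2 (by rw [← hfu]; linarith)
  refine ⟨(v, u), hpn, fun z hz => ?_⟩
  rw [connectedComponentIn_eq hp]
  have hsub : {y : HypSpace | 0 < mink (lift y) (v, u)} ⊆ (hull C)ᶜ := fun y hy hyC => by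
    have h2 := hf y.coord (subset_closure (mem_image_of_mem _ hyC))
    have h3 := mink_lift_pos_iff.1 hy
    rw [hfu] at h2
    simp only at h3
    linarith
  exact (isPreconnected_halfSpace (v, u)).subset_connectedComponentIn hpn hsub hz

theorem IsHullSide.isOpen {C : Set SphereAtInfinity} {U : Set HypSpace} (hU : IsHullSide C U) :
    IsOpen U := by
  refine isOpen_iff_mem_nhds.2 fun p hp => ?_
  obtain ⟨n, hn, h⟩ := hU.exists_halfSpace hp
  exact Filter.mem_of_superset ((isOpen_lt continuous_const (continuous_mink_lift n)).mem_nhds hn) h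

theorem IsHullSide.isConvex_compl {C : Set SphereAtInfinity} {U : Set HypSpace}
    (hU : IsHullSide C U) : IsConvex Uᶜ := by
  rintro _ ⟨a, ha, rfl⟩ _ ⟨b, hb, rfl⟩ s t hs ht hst
  have h1 : s • a.coord + t • b.coord ∈ ball (0 : E3) 1 :=
    (convex_ball 0 1) (mem_ball_zero_iff.2 a.norm_lt_one) (mem_ball_zero_iff.2 b.norm_lt_one)
      hs ht hst
  refine ⟨⟨_, mem_ball_zero_iff.1 h1⟩, fun hc => ?_, rfl⟩
  obtain ⟨n, hn, h⟩ := hU.exists_halfSpace hc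
  rw [mink_lift_pos_iff] at hn
  have h2 : ⟪a.coord, n.2⟫_ℝ - n.1 ≤ 0 := not_lt.1 fun h3 => ha (h a (mink_lift_pos_iff.2 h3))
  have h3 : ⟪b.coord, n.2⟫_ℝ - n.1 ≤ 0 := not_lt.1 fun h3 => hb (h b (mink_lift_pos_iff.2 h3))
  simp only [inner_add_left, real_inner_smul_left] at hn
  have h4 : s * ⟪a.coord, n.2⟫_ℝ + t * ⟪b.coord, n.2⟫_ℝ - n.1 =
      s * (⟪a.coord, n.2⟫_ℝ - n.1) + t * (⟪b.coord, n.2⟫_ℝ - n.1) := by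
    linear_combination (-n.1) * hst.symm
  nlinarith

theorem IsHullSide.nonempty {C : Set SphereAtInfinity} {U : Set HypSpace} (hU : IsHullSide C U) :
    U.Nonempty := by
  obtain ⟨p, hp, rfl⟩ := hU
  exact ⟨p, mem_connectedComponentIn hp⟩

theorem IsHullSide.disjoint {C : Set SphereAtInfinity} {U V : Set HypSpace} (hU : IsHullSide C U)
    (hV : IsHullSide C V) (h : U ≠ V) : Disjoint U V := by
  obtain ⟨p, -, rfl⟩ := hU
  obtain ⟨q, -, rfl⟩ := hV
  refine Set.disjoint_left.2 fun z hz hz' => h ?_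
  rw [connectedComponentIn_eq hz, connectedComponentIn_eq hz']

end HypSpace

/-! ### Path metrics and coarse maps -/

section PathMetric

variable {X Y : Type*} [MetricSpace X] [MetricSpace Y]

theorem pathEDist_comm (x y : X) : pathEDist x y = pathEDist y x := by
  have h : ∀ x y : X, pathEDist x y ≤ pathEDist y x := fun x y => by
    refine le_iInf fun γ => (iInf_le _ γ.symm).trans ?_
    exact eVariationOn.comp_le_of_antitoneOn γ unitInterval.symm
      (fun a _ b _ hab => unitInterval.symm_le_symm.2 hab) (mapsTo_univ _ _)
  exact le_antisymm (h x y) (h y x)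

theorem pathEDist_triangle (x y z : X) : pathEDist x z ≤ pathEDist x y + pathEDist y z := by
  refine ENNReal.le_iInf_add_iInf fun γ γ' => (iInf_le _ (γ.trans γ')).trans ?_
  set h : unitInterval := ⟨1 / 2, by norm_num, by norm_num⟩ with hh
  have hu := eVariationOn.union (γ.trans γ') (isGreatest_Iic (a := h)) isLeast_Ici
  rw [Iic_union_Ici] at hu
  refine hu.le.trans ?_
  refine add_le_add ?_ ?_
  · have h1 : EqOn (γ.trans γ') (γ ∘ fun t => projIcc 0 1 zero_le_one (2 * (t : ℝ))) (Iic h) := by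
      intro t ht
      have ht' : (t : ℝ) ≤ 1 / 2 := ht
      rw [Path.trans, Path.coe_mk_mk]
      simp only [Function.comp_apply, if_pos ht']
      rfl
    rw [eVariationOn.congr h1]
    refine eVariationOn.comp_le_of_monotoneOn γ _ (fun a _ b _ hab => monotone_projIcc _ ?_)
      (mapsTo_univ _ _)
    have : (a : ℝ) ≤ b := hab
    linarith
  · have h1 : EqOn (γ.trans γ') (γ' ∘ fun t => projIcc 0 1 zero_le_one (2 * (t : ℝ) - 1))
        (Ici h) := by
      intro t ht
      have ht' : 1 / 2 ≤ (t : ℝ) := ht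
      rw [Path.trans, Path.coe_mk_mk]
      simp only [Function.comp_apply]
      split_ifs with h2
      · have h3 : (t : ℝ) = 1 / 2 := le_antisymm h2 ht'
        rw [h3]
        norm_num
      · rfl
    rw [eVariationOn.congr h1]
    refine eVariationOn.comp_le_of_monotoneOn γ' _ (fun a _ b _ hab => monotone_projIcc _ ?_)
      (mapsTo_univ _ _)
    have : (a : ℝ) ≤ b := hab
    linarith

theorem pathEDist_le_of_lipschitzWith {x y : X} {D : ℝ≥0} {γ : unitInterval → X}
    (hγ : LipschitzWith D γ) (h0 : γ 0 = x) (h1 : γ 1 = y) : pathEDist x y ≤ D := by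
  refine (iInf_le _ ⟨⟨γ, hγ.continuous⟩, h0, h1⟩).trans ?_
  have h2 : eVariationOn (fun t : unitInterval => (t : ℝ)) univ ≤ 1 := by
    have h3 := MonotoneOn.eVariationOn_eq (f := fun t : unitInterval => (t : ℝ)) (s := univ)
      (fun a _ b _ hab => hab) (mem_univ 0) (mem_univ 1)
    have h4 : (univ : Set unitInterval) ∩ Icc 0 1 = univ :=
      eq_univ_of_forall fun t => ⟨mem_univ t, unitInterval.nonneg', unitInterval.le_one'⟩
    rw [h4] at h3
    simp [h3]
  have h3 := (hγ.lipschitzOnWith (s := univ)).comp_eVariationOn_le (g := id) (s := univ)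
    (mapsTo_univ _ _)
  calc eVariationOn γ univ ≤ D * eVariationOn (id : unitInterval → unitInterval) univ := h3
    _ ≤ D * 1 := mul_le_mul_right h2 _
    _ = D := mul_one _

/-- A path is cut greedily into pieces whose end points are at distance `ε`; each piece uses up at
least `ε` of the length. -/
theorem pathEDist_map_le_of_eVariationOn_le {f : X → Y} {ε A : ℝ≥0}
    (hf : ∀ x x', dist x x' ≤ ε → pathEDist (f x) (f x') ≤ A) {x y : X} (γ : Path x y) (k : ℕ) :
    ∀ a : unitInterval, eVariationOn γ (Icc a 1) ≤ k * ε →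
      pathEDist (f (γ a)) (f (γ 1)) ≤ (k + 1) * A := by
  induction k with
  | zero =>
    intro a ha
    have h1 := eVariationOn.edist_le γ (left_mem_Icc.2 (unitInterval.le_one' (t := a)))
      (right_mem_Icc.2 unitInterval.le_one')
    have h2 : edist (γ a) (γ 1) ≤ ε := h1.trans (ha.trans (by simp))
    rw [edist_nndist, ENNReal.coe_le_coe] at h2
    simpa using hf _ _ (NNReal.coe_le_coe.2 h2)
  | succ k ih =>
    intro a ha
    by_cases h : dist (γ a) (γ 1) ≤ ε
    · refine (hf _ _ h).trans ?_
      exact le_mul_of_one_le_left' (by simp)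
    · push Not at h
      obtain ⟨t, ht, hte⟩ : (ε : ℝ) ∈ (fun t => dist (γ a) (γ t)) '' Icc a 1 :=
        intermediate_value_Icc (f := fun t => dist (γ a) (γ t)) unitInterval.le_one'
          (by fun_prop) ⟨by simp, h.le⟩
      have h1 := eVariationOn.edist_le γ (left_mem_Icc.2 ht.1) (right_mem_Icc.2 ht.1)
      have h2 : edist (γ a) (γ t) = ε := by
        rw [edist_dist]
        simp only at hte
        rw [hte, ENNReal.ofReal_coe_nnreal]
      have h3 := eVariationOn.Icc_add_Icc γ ht.1 ht.2 (mem_univ t)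
      simp only [univ_inter] at h3
      have h4 : eVariationOn γ (Icc t 1) ≤ k * ε := by
        refine (ENNReal.add_le_add_iff_left (ENNReal.coe_ne_top (r := ε))).1 ?_
        calc (ε : ℝ≥0∞) + eVariationOn γ (Icc t 1)
            ≤ eVariationOn γ (Icc a t) + eVariationOn γ (Icc t 1) :=
              add_le_add_left (h2 ▸ h1) _
          _ ≤ _ := h3 ▸ ha
          _ = ε + k * ε := by push_cast; ring
      calc pathEDist (f (γ a)) (f (γ 1))
          ≤ pathEDist (f (γ a)) (f (γ t)) + pathEDist (f (γ t)) (f (γ 1)) :=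
            pathEDist_triangle _ _ _
        _ ≤ A + (k + 1) * A := add_le_add (hf _ _ hte.le) (ih t h4)
        _ = _ := by push_cast; ring

/-- A map that moves points at distance at most `ε` to points at bounded path distance is coarsely
Lipschitz for the path metrics. -/
theorem pathEDist_map_le {f : X → Y} {ε A L : ℝ≥0} (hε : 0 < ε) (hL : A ≤ L * ε) (hL0 : L ≠ 0)
    (hf : ∀ x x', dist x x' ≤ ε → pathEDist (f x) (f x') ≤ A) (x x' : X) :
    pathEDist (f x) (f x') ≤ L * pathEDist x x' + 2 * A := by
  have h1 : ∀ γ : Path x x', pathEDist (f x) (f x') ≤ L * eVariationOn γ univ + 2 * A := by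
    intro γ
    rcases eq_or_ne (eVariationOn γ univ) ⊤ with h | h
    · rw [h, ENNReal.mul_top (by simpa using hL0), top_add]
      exact le_top
    lift eVariationOn γ univ to ℝ≥0 using h with v hv
    have h2 : v ≤ ⌈v / ε⌉₊ * ε := by
      rw [← div_le_iff₀ hε]; exact Nat.le_ceil _
    have h3 := pathEDist_map_le_of_eVariationOn_le hf γ ⌈v / ε⌉₊ 0 (by
      refine (eVariationOn.mono γ (subset_univ _)).trans ?_
      rw [← hv]
      exact_mod_cast h2)
    rw [γ.source, γ.target] at h3
    refine h3.trans ?_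
    have h4 : ((⌈v / ε⌉₊ : ℝ≥0) + 1) * A ≤ L * v + 2 * A := by
      have h5 : (⌈v / ε⌉₊ : ℝ≥0) ≤ v / ε + 1 := (Nat.ceil_lt_add_one zero_le).le
      have h6 : v / ε * A ≤ L * v := by
        calc v / ε * A ≤ v / ε * (L * ε) := by gcongr
          _ = L * v := by field_simp
      calc ((⌈v / ε⌉₊ : ℝ≥0) + 1) * A ≤ (v / ε + 1 + 1) * A := by gcongr
        _ = v / ε * A + 2 * A := by ring
        _ ≤ _ := by gcongr
    exact_mod_cast h4
  rw [pathEDist, pathEDist, ENNReal.mul_iInf_of_ne (by simpa using hL0) ENNReal.coe_ne_top,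
    ENNReal.iInf_add]
  exact le_iInf h1

/-- Two coarsely inverse maps that move points at distance at most `ε` to points at bounded path
distance are quasi-isometries. -/
theorem isQuasiIsometryWith_of_coarse_inverse {f : X → Y} {g : Y → X} {ε A L : ℝ≥0} (hε : 0 < ε)
    (hL : A ≤ L * ε) (hL1 : 1 ≤ L)
    (hf : ∀ x x', dist x x' ≤ ε → pathEDist (f x) (f x') ≤ A)
    (hg : ∀ y y', dist y y' ≤ ε → pathEDist (g y) (g y') ≤ A)
    (hgf : ∀ x, pathEDist (g (f x)) x ≤ A) (hfg : ∀ y, pathEDist (f (g y)) y ≤ A) :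
    IsQuasiIsometryWith L (4 * A) f := by
  have hL0 : L ≠ 0 := (zero_lt_one.trans_le hL1).ne'
  refine ⟨fun x x' => ?_, fun x x' => ?_, fun y => ⟨g y, ?_⟩⟩
  · refine (pathEDist_map_le hε hL hL0 hf x x').trans ?_
    push_cast
    gcongr
    norm_num
  · have h1 : pathEDist x x' ≤ L * pathEDist (f x) (f x') + 4 * A := by
      calc pathEDist x x' ≤ pathEDist x (g (f x)) + pathEDist (g (f x)) x' :=
            pathEDist_triangle _ _ _
        _ ≤ pathEDist x (g (f x)) +
            (pathEDist (g (f x)) (g (f x')) + pathEDist (g (f x')) x') := by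
            gcongr
            exact pathEDist_triangle _ _ _
        _ ≤ A + ((L * pathEDist (f x) (f x') + 2 * A) + A) := by
            gcongr
            · rw [pathEDist_comm]; exact hgf x
            · exact pathEDist_map_le hε hL hL0 hg _ _
            · exact hgf x'
        _ = _ := by ring
    rw [tsub_le_iff_right]
    have hLe : (L : ℝ≥0∞) ≠ 0 := by simpa using hL0
    calc (L : ℝ≥0∞)⁻¹ * pathEDist x x' ≤ (L : ℝ≥0∞)⁻¹ * (L * pathEDist (f x) (f x') + 4 * A) := by
          gcongr
      _ = pathEDist (f x) (f x') + (L : ℝ≥0∞)⁻¹ * (4 * A) := by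
          rw [mul_add, ← mul_assoc, ENNReal.inv_mul_cancel hLe ENNReal.coe_ne_top, one_mul]
      _ ≤ pathEDist (f x) (f x') + 1 * (4 * A) := by
          gcongr
          exact ENNReal.inv_le_one.2 (by exact_mod_cast hL1)
      _ = _ := by push_cast; ring
  · rw [pathEDist_comm]
    refine (hfg y).trans ?_
    push_cast
    exact le_mul_of_one_le_left' (by norm_num)

end PathMetric

namespace HypSpace

/-! ### Half-spaces near a point -/

/-- Let the plane of unit normal `m` contain `y`, and let the planes of unit normals `n`, `n'` pass
within `arsinh s` of `y`. If `n` and `n'` have products at most `-1` with `m`, then, seen from `y`,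
both make an angle with `-m` whose cosine is at least `1 / √(1 + s ^ 2)`; this bounds their product
from below. -/
theorem one_sub_le_mink_normals {y : HypSpace} {m n n' : ℝ × E3} {s : ℝ} (hm : mink m m = 1)
    (hn : mink n n = 1) (hn' : mink n' n' = 1) (hym : mink (lift y) m = 0)
    (hnm : mink n m ≤ -1) (hnm' : mink n' m ≤ -1)
    (hy : mink (lift y) n ≤ 0) (hy' : mink (lift y) n' ≤ 0) (hs : -s ≤ mink (lift y) n)
    (hs' : -s ≤ mink (lift y) n') : 1 - 2 * s ^ 2 ≤ mink n n' := by
  obtain ⟨σ, hσ⟩ : ∃ σ, mink (lift y) n = -σ := ⟨_, (neg_neg _).symm⟩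
  obtain ⟨σ', hσ'⟩ : ∃ σ', mink (lift y) n' = -σ' := ⟨_, (neg_neg _).symm⟩
  obtain ⟨p, hp⟩ : ∃ p, mink n m = -p := ⟨_, (neg_neg _).symm⟩
  obtain ⟨p', hp'⟩ : ∃ p', mink n' m = -p' := ⟨_, (neg_neg _).symm⟩
  rw [hσ] at hy hs
  rw [hσ'] at hy' hs'
  rw [hp] at hnm
  rw [hp'] at hnm'
  have e1 : mink n (lift y) = -σ := by rw [mink_comm, hσ]
  have e1' : mink n' (lift y) = -σ' := by rw [mink_comm, hσ']
  have e2 : mink m n = -p := by rw [mink_comm, hp]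
  have e2' : mink m n' = -p' := by rw [mink_comm, hp']
  have e3 : mink m (lift y) = 0 := by rw [mink_comm, hym]
  -- the components of `n` and `n'` orthogonal to `y` and to `m`
  have h := mink_le_mul_of_orthogonal (u := n - σ • lift y + p • m) (v := n' - σ' • lift y + p' • m)
    (A := σ) (B := σ') (mink_lift_self_neg y)
    (by simp only [mink_add_right, mink_sub_right, mink_smul_right, mink_lift_self, hσ, hym]; ring)
    (by simp only [mink_add_right, mink_sub_right, mink_smul_right, mink_lift_self, hσ', hym]; ring)
    (by linarith) (by linarith)
    (by
      simp only [mink_add_left, mink_sub_left, mink_smul_left, mink_add_right, mink_sub_right,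
        mink_smul_right, mink_lift_self, hσ, hym, hp, hn, hm, e1, e2, e3]
      nlinarith)
    (by
      simp only [mink_add_left, mink_sub_left, mink_smul_left, mink_add_right, mink_sub_right,
        mink_smul_right, mink_lift_self, hσ', hym, hp', hn', hm, e1', e2', e3]
      nlinarith)
  simp only [mink_add_left, mink_sub_left, mink_smul_left, mink_add_right, mink_sub_right,
    mink_smul_right, mink_lift_self, hσ', hym, hp, hm, e1, e2', e3] at h
  have h2 := (abs_le.1 h).1
  have h3 : 1 ≤ p * p' := by nlinarith
  have h4 : σ * σ' ≤ s * s := mul_le_mul (by linarith) (by linarith) (by linarith) (by linarith)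
  nlinarith

/-- The point `z` of hyperbolic space over `y + t (n + n')`, which is timelike as long as its
Minkowski square `-N` is negative: its position relative to the planes of `n` and `n'`, and its
distance from `y`. -/
theorem exists_move_toward_normals (y : HypSpace) {n n' : ℝ × E3} (hn : mink n n = 1)
    (hn' : mink n' n' = 1) {σ σ' t : ℝ} (hσ : mink (lift y) n = -σ) (hσ' : mink (lift y) n' = -σ')
    (hσ0 : 0 ≤ σ) (hσ0' : 0 ≤ σ') (ht : 0 ≤ t) {N : ℝ} (hN : 0 < N)
    (hNt : N = 1 + 2 * t * (σ + σ') - 2 * t ^ 2 * (1 + mink n n')) :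
    ∃ z : HypSpace, mink (lift z) n = (√N)⁻¹ * (t * (1 + mink n n') - σ) ∧
      mink (lift z) n' = (√N)⁻¹ * (t * (1 + mink n n') - σ') ∧
      Real.cosh (dist y z) = (√N)⁻¹ * (1 + t * (σ + σ')) := by
  have e1 : mink n (lift y) = -σ := by rw [mink_comm, hσ]
  have e1' : mink n' (lift y) = -σ' := by rw [mink_comm, hσ']
  have e2 : mink n' n = mink n n' := mink_comm _ _
  have hv : mink (lift y + t • (n + n')) (lift y + t • (n + n')) = -N := by
    simp only [mink_add_left, mink_smul_left, mink_add_right, mink_smul_right, mink_lift_self, hσ,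
      hσ', e1, e1', e2, hn, hn', hNt]
    ring
  have hy : mink (lift y) (lift y + t • (n + n')) = -(1 + t * (σ + σ')) := by
    simp only [mink_add_right, mink_smul_right, mink_lift_self, hσ, hσ']
    ring
  obtain ⟨z, hz⟩ := exists_lift_eq_smul y (v := lift y + t • (n + n')) (by rw [hv]; linarith)
    (by rw [hy]; nlinarith [mul_nonneg ht (add_nonneg hσ0 hσ0')])
  rw [hv, neg_neg] at hz
  refine ⟨z, ?_, ?_, ?_⟩
  · simp only [hz, mink_smul_left, mink_add_left, hσ, hn, e2]
    ring
  · simp only [hz, mink_smul_left, mink_add_left, hσ', hn']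
    ring
  · have h := mink_lift_lift y z
    rw [hz, mink_smul_right, hy] at h
    linarith

/-- Two closed half-spaces whose boundary planes are far from being tangent at infinity meet near
every point that is close to both planes. -/
theorem exists_mem_halfSpaces_cosh_dist_le (y : HypSpace) {n n' : ℝ × E3} (hn : mink n n = 1)
    (hn' : mink n' n' = 1) {s k : ℝ} (hy : mink (lift y) n ≤ 0) (hy' : mink (lift y) n' ≤ 0)
    (hs : -s ≤ mink (lift y) n) (hs' : -s ≤ mink (lift y) n') (hk : 0 < k)
    (hkn : k ≤ 1 + mink n n') :
    ∃ z : HypSpace, 0 ≤ mink (lift z) n ∧ 0 ≤ mink (lift z) n' ∧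
      Real.cosh (dist y z) ≤ 1 + 2 * s ^ 2 / k := by
  obtain ⟨σ, hσ⟩ : ∃ σ, mink (lift y) n = -σ := ⟨_, (neg_neg _).symm⟩
  obtain ⟨σ', hσ'⟩ : ∃ σ', mink (lift y) n' = -σ' := ⟨_, (neg_neg _).symm⟩
  rw [hσ] at hy hs
  rw [hσ'] at hy' hs'
  set K := 1 + mink n n'
  have hK : 0 < K := hk.trans_le hkn
  set M := max σ σ' with hM
  have h1 : σ ≤ M := le_max_left _ _
  have h2 : σ' ≤ M := le_max_right _ _
  have hMs : M ≤ s := max_le (by linarith) (by linarith)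
  have hM' : M ≤ σ + σ' := max_le (by linarith) (by linarith)
  -- the least time at which both half-spaces are reached
  set t := M / K with ht
  have ht0 : 0 ≤ t := div_nonneg (by linarith) hK.le
  have htK : t * K = M := div_mul_cancel₀ _ hK.ne'
  set N := 1 + 2 * t * (σ + σ') - 2 * t ^ 2 * K with hN
  have hN1 : 1 ≤ N := by
    have : N = 1 + 2 * (t * (σ + σ' - M)) := by rw [hN, ← htK]; ring
    nlinarith [mul_nonneg ht0 (sub_nonneg.2 hM')]
  obtain ⟨z, hz1, hz2, hz3⟩ := exists_move_toward_normals y hn hn' hσ hσ' (by linarith)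
    (by linarith) ht0 (by linarith) hN
  refine ⟨z, ?_, ?_, ?_⟩
  · rw [hz1]
    exact mul_nonneg (by positivity) (by linarith)
  · rw [hz2]
    exact mul_nonneg (by positivity) (by linarith)
  · have h3 : (√N)⁻¹ ≤ 1 := inv_le_one_of_one_le₀ (Real.one_le_sqrt.2 hN1)
    have h4 : t ≤ s / k := div_le_div₀ (by linarith) hMs hk hkn
    have h5 : t * (σ + σ') ≤ s / k * (s + s) :=
      mul_le_mul h4 (by linarith) (by linarith) (ht0.trans h4)
    have h6 : 0 ≤ t * (σ + σ') := mul_nonneg ht0 (by linarith)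
    rw [hz3]
    calc (√N)⁻¹ * (1 + t * (σ + σ')) ≤ 1 * (1 + t * (σ + σ')) :=
          mul_le_mul_of_nonneg_right h3 (by linarith)
      _ ≤ 1 + s / k * (s + s) := by linarith
      _ = 1 + 2 * s ^ 2 / k := by ring

/-- Disjoint half-spaces have unit normals with product at most `-1`: their boundary planes do not
cross. -/
theorem mink_normals_le_neg_one {y : HypSpace} {m n : ℝ × E3} (hm : mink m m = 1)
    (hn : mink n n = 1) (hym : mink (lift y) m = 0) (hyn : mink (lift y) n ≤ 0)
    (hdisj : ∀ z, 0 < mink (lift z) n → ¬ 0 < mink (lift z) m) : mink n m ≤ -1 := by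
  by_contra! hlt
  obtain ⟨σ, hσ⟩ : ∃ σ, mink (lift y) n = -σ := ⟨_, (neg_neg _).symm⟩
  rw [hσ] at hyn
  set K := 1 + mink n m with hK
  have hK0 : 0 < K := by linarith
  -- `δ` is small enough for the moved point to stay inside the light cone
  set δ := (2 * (1 + σ + K))⁻¹ with hδ
  have hδ0 : 0 < δ := by rw [hδ]; apply inv_pos.2; linarith
  have hδ1 : 2 * δ * (1 + σ + K) = 1 := by
    rw [hδ]
    have : 1 + σ + K ≠ 0 := by linarith
    field_simp
  have hσ0 : 0 ≤ σ := by linarith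
  set t := σ / K + δ with ht
  have ht0 : 0 < t := add_pos_of_nonneg_of_pos (div_nonneg hσ0 hK0.le) hδ0
  have htK : t * K = σ + δ * K := by rw [ht, add_mul, div_mul_cancel₀ _ hK0.ne']
  have hδK : 0 < δ * K := mul_pos hδ0 hK0
  have hN : 0 < 1 + 2 * t * (σ + 0) - 2 * t ^ 2 * K := by
    have h1 : 1 + 2 * t * (σ + 0) - 2 * t ^ 2 * K = 1 - 2 * (σ + δ * K) * δ := by
      linear_combination (-2 * t - 2 * δ) * htK
    have h2 : δ ≤ 1 := by nlinarith
    have h3 : δ * K * δ ≤ K * δ := by nlinarith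
    nlinarith
  obtain ⟨z, hz1, hz2, -⟩ := exists_move_toward_normals y hn hm hσ (σ' := 0) (by simpa using hym)
    hσ0 le_rfl ht0.le hN rfl
  have hN' := inv_pos.2 (Real.sqrt_pos.2 hN)
  refine hdisj z ?_ ?_
  · rw [hz1]
    exact mul_pos hN' (by rw [← hK]; linarith)
  · rw [hz2]
    exact mul_pos hN' (by rw [← hK]; linarith)

/-! ### The path metric of a boundary surface -/

/-- The retraction of a geodesic in a closed half-space on the side of `U` is a path in the frontier
of `U`. -/
theorem pathEDist_retraction_le {U : Set HypSpace} {r : HypSpace → HypSpace}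
    (hr : LipschitzWith 1 r) (hrU : ∀ p ∈ closure U, r p ∈ frontier U) {n : ℝ × E3}
    (hn : mink n n = 1) (hU : ∀ z, 0 < mink (lift z) n → z ∈ U) {p q : HypSpace}
    (hp : 0 ≤ mink (lift p) n) (hq : 0 ≤ mink (lift q) n) {p' q' : frontier U}
    (hp' : r p = p') (hq' : r q = q') : pathEDist p' q' ≤ ENNReal.ofReal (dist p q) := by
  obtain ⟨γ, h0, h1, hlip, hhalf⟩ := exists_geodesic p q
  have hcl : ∀ t : unitInterval, r (γ t) ∈ frontier U := fun t =>
    hrU _ (mem_closure_of_mink_nonneg (snd_ne_zero_of_mink_self_pos (by rw [hn]; norm_num)) hU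
      (hhalf n hp hq t t.2.1 t.2.2))
  have hγ : LipschitzWith (Real.toNNReal (dist p q))
      (fun t : unitInterval => (⟨r (γ t), hcl t⟩ : frontier U)) := by
    refine LipschitzWith.of_dist_le_mul fun s t => ?_
    rw [Real.coe_toNNReal _ dist_nonneg]
    refine (hr.dist_le_mul _ _).trans ?_
    rw [NNReal.coe_one, one_mul]
    exact hlip s t
  exact pathEDist_le_of_lipschitzWith hγ (Subtype.ext (by simp [h0, hp']))
    (Subtype.ext (by simp [h1, hq']))

/-- Two points of one boundary surface that are within `d < arsinh 1` of a common point of the other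
boundary surface are at bounded path distance: their outer half-spaces meet near that point, and the
broken geodesic through a common point of the half-spaces is retracted to the surface. -/
theorem pathEDist_frontier_le {U V : Set HypSpace} (hU : IsOpen U) (hV : IsOpen V)
    (hUc : IsConvex Uᶜ) (hVc : IsConvex Vᶜ) (hUV : Disjoint U V) (hU0 : U.Nonempty)
    (hV0 : V.Nonempty) {d : ℝ} (hd : Real.sinh d < 1) {y : HypSpace} (hy : y ∈ frontier V)
    {x x' : frontier U} (hx : dist (x : HypSpace) y ≤ d) (hx' : dist (x' : HypSpace) y ≤ d) :
    pathEDist x x' ≤ ENNReal.ofReal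
      (2 * (d + Real.arcosh (1 + 2 * Real.sinh d ^ 2 / (2 - 2 * Real.sinh d ^ 2)))) := by
  have hd0 : 0 ≤ d := dist_nonneg.trans hx
  have hs0 : 0 ≤ Real.sinh d := Real.sinh_nonneg_iff.2 hd0
  have hVU : V ⊆ interior Uᶜ := hV.subset_interior_iff.2 hUV.subset_compl_left
  have hUV' : U ⊆ interior Vᶜ := hU.subset_interior_iff.2 hUV.subset_compl_right
  obtain ⟨n, hn, hxn, hnU⟩ := exists_unit_normal hUc (hV0.mono hVU) x.2
  obtain ⟨n', hn', hxn', hnU'⟩ := exists_unit_normal hUc (hV0.mono hVU) x'.2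
  obtain ⟨m, hm, hym, hmV⟩ := exists_unit_normal hVc (hU0.mono hUV') hy
  have hyU : y ∉ U := fun h => (hUV.closure_right hU).ne_of_mem h hy.1 rfl
  have hnear : ∀ {x : HypSpace} {n : ℝ × E3}, mink n n = 1 → mink (lift x) n = 0 →
      (∀ z, 0 < mink (lift z) n → z ∈ U) → dist x y ≤ d →
      mink (lift y) n ≤ 0 ∧ -Real.sinh d ≤ mink (lift y) n ∧ mink n m ≤ -1 := by
    intro x n hn hxn hnU hx
    have h1 : mink (lift y) n ≤ 0 := not_lt.1 fun h => hyU (hnU y h)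
    refine ⟨h1, ?_, mink_normals_le_neg_one hm hn hym h1
      fun z hz hz' => hUV.ne_of_mem (hnU z hz) (hmV z hz') rfl⟩
    have h2 := (abs_le.1 (abs_mink_lift_le_sinh_dist (y := y) hn hxn)).1
    have h3 := Real.sinh_le_sinh.2 hx
    linarith
  obtain ⟨h1, h2, h3⟩ := hnear hn hxn hnU hx
  obtain ⟨h1', h2', h3'⟩ := hnear hn' hxn' hnU' hx'
  have hkey := one_sub_le_mink_normals hm hn hn' hym h3 h3' h1 h1' h2 h2'
  have hk : 0 < 2 - 2 * Real.sinh d ^ 2 := by nlinarith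
  obtain ⟨z, hz, hz', hyz⟩ := exists_mem_halfSpaces_cosh_dist_le y hn hn' h1 h1' h2 h2' hk
    (by linarith)
  set D := Real.arcosh (1 + 2 * Real.sinh d ^ 2 / (2 - 2 * Real.sinh d ^ 2)) with hD
  have hyzD : dist y z ≤ D := by
    rw [← Real.arcosh_cosh (dist_nonneg (x := y) (y := z)), hD]
    exact (Real.arcosh_le_arcosh (Real.cosh_pos _) (by positivity)).2 hyz
  obtain ⟨r, hr, hrU, hrfix⟩ := exists_lipschitz_retraction_frontier hU hUc
    ((hV0.mono hVU).mono interior_subset)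
  have hfr : ∀ x : frontier U, r x = x := fun x => hrfix x (hU.frontier_eq.subset x.2).2
  have hzU : z ∈ closure U :=
    mem_closure_of_mink_nonneg (snd_ne_zero_of_mink_self_pos (by rw [hn]; norm_num)) hnU hz
  have hp := pathEDist_retraction_le hr hrU hn hnU hxn.ge hz (hfr x)
    (q' := ⟨r z, hrU z hzU⟩) rfl
  have hq := pathEDist_retraction_le hr hrU hn' hnU' hz' hxn'.ge
    (p' := ⟨r z, hrU z hzU⟩) rfl (hfr x')
  refine (pathEDist_triangle _ _ _).trans ((add_le_add hp hq).trans ?_)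
  rw [← ENNReal.ofReal_add dist_nonneg dist_nonneg]
  refine ENNReal.ofReal_le_ofReal ?_
  have h4 := dist_triangle (x : HypSpace) y z
  have h5 := dist_triangle z y (x' : HypSpace)
  rw [dist_comm z y, dist_comm y (x' : HypSpace)] at h5
  linarith

end HypSpace

/-! ### Nearest-point projections between the boundary surfaces -/

theorem dist_le_of_isNearestPointProjection {S T : Set HypSpace} {f : S → T}
    (hf : IsNearestPointProjection f) {w : ℝ≥0} (hw : ⨆ x ∈ S, infEDist x T ≤ w) (x : S) :
    dist (f x : HypSpace) x ≤ w := by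
  have h : edist (x : HypSpace) (f x : HypSpace) ≤ w :=
    (hf x).le.trans ((le_iSup₂ (f := fun x (_ : x ∈ S) => infEDist x T) x.1 x.2).trans hw)
  rw [edist_nndist, ENNReal.coe_le_coe, ← NNReal.coe_le_coe, coe_nndist] at h
  rwa [dist_comm]

theorem sinh_lt_one_of_lt_arcosh_sqrt_two {d : ℝ} (hd0 : 0 ≤ d) (hd : d < Real.arcosh (√2)) :
    Real.sinh d < 1 := by
  have h1 : (1 : ℝ) ≤ √2 := Real.one_le_sqrt.2 one_le_two
  have h2 : Real.cosh d < √2 := by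
    rw [← Real.cosh_arcosh h1, Real.cosh_lt_cosh, abs_of_nonneg hd0,
      abs_of_nonneg (Real.arcosh_nonneg h1)]
    exact hd
  have h3 : Real.cosh d ^ 2 < 2 := by
    rw [← Real.sq_sqrt (zero_le_two (α := ℝ))]
    exact pow_lt_pow_left₀ h2 (Real.cosh_pos d).le two_ne_zero
  have h4 := Real.cosh_sq d
  nlinarith

theorem mainTheorem5 (w : ℝ≥0) (hw : (w : ℝ) < Real.arcosh (√2)) :
    ∃ L A : ℝ≥0, 1 ≤ L ∧
      ∀ (C : Set SphereAtInfinity) (Sp Sm : Set HypSpace),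
        IsJordanCurve C → HypSpace.IsBoundaryPair C Sp Sm → boundaryWidth Sp Sm ≤ w →
        ∀ (πp : Sm → Sp) (πm : Sp → Sm),
          IsNearestPointProjection πp → IsNearestPointProjection πm →
          IsQuasiIsometryWith L A πp ∧ IsQuasiIsometryWith L A πm ∧
            IsQuasiInverseWith A πp πm := by
  obtain ⟨d, hwd, hd⟩ := exists_between hw
  have hd0 : 0 ≤ d := w.2.trans hwd.le
  have hsinh := sinh_lt_one_of_lt_arcosh_sqrt_two hd0 hd
  set B : ℝ := 2 * (d + Real.arcosh (1 + 2 * Real.sinh d ^ 2 / (2 - 2 * Real.sinh d ^ 2))) with hB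
  set A : ℝ≥0 := B.toNNReal with hA
  -- the slack `ε` allows the points that are projected to move
  set ε : ℝ≥0 := (d - w).toNNReal with hε
  have hεd : (ε : ℝ) = d - w := Real.coe_toNNReal _ (by linarith)
  have hε0 : 0 < ε := by rw [← NNReal.coe_pos, hεd]; linarith
  refine ⟨max 1 (A / ε), 4 * A, le_max_left _ _, ?_⟩
  rintro C _ _ - ⟨U, V, hU, hV, hne, rfl, rfl⟩ hwidth πp πm hπp hπm
  have hUV := hU.disjoint hV hne
  have hp := dist_le_of_isNearestPointProjection hπp ((le_max_right _ _).trans hwidth)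
  have hm := dist_le_of_isNearestPointProjection hπm ((le_max_left _ _).trans hwidth)
  have hUd : ∀ (y : frontier V) (x x' : frontier U), dist (x : HypSpace) y ≤ d →
      dist (x' : HypSpace) y ≤ d → pathEDist x x' ≤ A := fun y x x' h h' =>
    HypSpace.pathEDist_frontier_le hU.isOpen hV.isOpen hU.isConvex_compl hV.isConvex_compl hUV
      hU.nonempty hV.nonempty hsinh y.2 h h'
  have hVd : ∀ (y : frontier U) (x x' : frontier V), dist (x : HypSpace) y ≤ d →
      dist (x' : HypSpace) y ≤ d → pathEDist x x' ≤ A := fun y x x' h h' =>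
    HypSpace.pathEDist_frontier_le hV.isOpen hU.isOpen hV.isConvex_compl hU.isConvex_compl hUV.symm
      hV.nonempty hU.nonempty hsinh y.2 h h'
  have hf : ∀ y y' : frontier V, dist y y' ≤ ε → pathEDist (πp y) (πp y') ≤ A := by
    intro y y' h
    refine hUd y _ _ ((hp y).trans hwd.le) ?_
    have h1 := dist_triangle (πp y' : HypSpace) y' y
    have h2 := hp y'
    rw [Subtype.dist_eq, dist_comm, hεd] at h
    linarith
  have hg : ∀ x x' : frontier U, dist x x' ≤ ε → pathEDist (πm x) (πm x') ≤ A := by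
    intro x x' h
    refine hVd x _ _ ((hm x).trans hwd.le) ?_
    have h1 := dist_triangle (πm x' : HypSpace) x' x
    have h2 := hm x'
    rw [Subtype.dist_eq, dist_comm, hεd] at h
    linarith
  have hgf : ∀ y, pathEDist (πm (πp y)) y ≤ A := fun y =>
    hVd (πp y) _ _ ((hm _).trans hwd.le) (by rw [dist_comm]; exact (hp y).trans hwd.le)
  have hfg : ∀ x, pathEDist (πp (πm x)) x ≤ A := fun x =>
    hUd (πm x) _ _ ((hp _).trans hwd.le) (by rw [dist_comm]; exact (hm x).trans hwd.le)
  have hL : A ≤ max 1 (A / ε) * ε := by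
    rw [← div_le_iff₀ hε0]
    exact le_max_right _ _
  have hA4 : (A : ℝ≥0∞) ≤ (4 * A : ℝ≥0) := by
    exact_mod_cast le_mul_of_one_le_left' (by norm_num)
  exact ⟨isQuasiIsometryWith_of_coarse_inverse hε0 hL (le_max_left _ _) hf hg hgf hfg,
    isQuasiIsometryWith_of_coarse_inverse hε0 hL (le_max_left _ _) hg hf hfg hgf,
    fun y => (hgf y).trans hA4, fun x => (hfg x).trans hA4⟩
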